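/- Let $X$ be a compact metric space (hence complete) that is locally $CAT(0)$, i.e. every point $x\in X$ has a ball $B(x,r)$, $r>0$, which with the induced metric is a (geodesic) $CAT(0)$-space. Let $Z\subseteq X$ be a compact, locally convex subspace: every $z\in Z$ has a ball $B(z,r)$, $r>0$, such that any two points of $Z\cap B(z,r)$ are joined by a geodesic of $X$ and every such geodesic is contained in $Z\cap B(z,r)$. Suppose that $X$ is negatively curved around $Z$: there are a neighbourhood $U$ of $Z$ in $X$ and a constant $\kappa>0$ such that $U\setminus Z$, with the induced metric, is locally $CAT(-\kappa)$, i.e. every point of $U\setminus Z$ is the centre of a ball of $U\setminus Z$ which is a (geodesic) $CAT(-\kappa)$-space. Then for every base point $z\in Z$ the homomorphism $\pi_1(Z,z)\to \pi_1(X,z)$ induced by the inclusion is injective, and its image $H$ is a malnormal subgroup of $G=\pi_1(X,z)$: $gHg^{-1}\cap H=\{1\}$ for every $g\in G\setminus H$. -/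

import Mathlib

open scoped Topology

/-- `A` is the image of a geodesic of the metric space `X` from `x` to `y`, that is, of an isometric
map `γ : [0, d(x, y)] → X` with `γ 0 = x` and `γ (d(x, y)) = y`. -/
def IsGeodesicSegment {X : Type*} [MetricSpace X] (x y : X) (A : Set X) : Prop :=
  ∃ γ : ℝ → X, γ 0 = x ∧ γ (dist x y) = y ∧
    (∀ s ∈ Set.Icc 0 (dist x y), ∀ t ∈ Set.Icc 0 (dist x y), dist (γ s) (γ t) = |s - t|) ∧
    A = γ '' Set.Icc 0 (dist x y)

/-- `S`, with the induced metric, is a geodesic space: any two of its points are joined by a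
geodesic that stays in `S`. -/
def IsGeodesicSubset {X : Type*} [MetricSpace X] (S : Set X) : Prop :=
  ∀ x ∈ S, ∀ y ∈ S, ∃ A, IsGeodesicSegment x y A ∧ A ⊆ S

/-- `C` is convex in the metric space `X`: any two points of `C` are joined by a geodesic of `X`,
and every such geodesic is contained in `C`. -/
def IsGeodesicallyConvex {X : Type*} [MetricSpace X] (C : Set X) : Prop :=
  ∀ x ∈ C, ∀ y ∈ C, (∃ A, IsGeodesicSegment x y A) ∧ ∀ A, IsGeodesicSegment x y A → A ⊆ C

/-- `Z` is locally convex in `X`: each of its points is the centre of a ball that meets `Z` in a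
convex set. -/
def IsLocallyConvex {X : Type*} [MetricSpace X] (Z : Set X) : Prop :=
  ∀ z ∈ Z, ∃ r > 0, IsGeodesicallyConvex (Z ∩ Metric.ball z r)

/-- The CAT comparison inequality for the geodesic triangles of `S` (with the induced metric), the
model being the metric space `M` with its metric multiplied by `1 / c`. For a triangle with
vertices `p, q, r` and sides `A, B, C`, points `x` and `y` on the sides issuing from `p`, a
comparison triangle `p', q', r'` in the model and the comparison points `x'` on `[p', q']` and
`y'` on `[p', r']`, the distance of `x` and `y` is at most that of `x'` and `y'`. Since the vertex
`p` is arbitrary, this covers any two points on distinct sides. -/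
def SatisfiesComparison (M : Type) [MetricSpace M] (c : ℝ) {X : Type*} [MetricSpace X]
    (S : Set X) : Prop :=
  ∀ p q r : X, ∀ A B C : Set X,
    IsGeodesicSegment p q A → IsGeodesicSegment p r B → IsGeodesicSegment q r C →
    A ⊆ S → B ⊆ S → C ⊆ S →
    ∀ x ∈ A, ∀ y ∈ B, ∀ p' q' r' x' y' : M,
      dist p' q' = c * dist p q → dist p' r' = c * dist p r → dist q' r' = c * dist q r →
      dist p' x' = c * dist p x → dist x' q' = c * dist x q →
      dist p' y' = c * dist p y → dist y' r' = c * dist y r →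
      c * dist x y ≤ dist x' y'

/-- `S`, with the induced metric, is a CAT(0) space: the model is the Euclidean plane. -/
def IsCATZero {X : Type*} [MetricSpace X] (S : Set X) : Prop :=
  IsGeodesicSubset S ∧ SatisfiesComparison (EuclideanSpace ℝ (Fin 2)) 1 S

/-- `S`, with the induced metric, is a CAT(-k) space, for `k > 0`: the model is the hyperbolic
plane (of curvature `-1`) with its metric divided by `√k`. -/
def IsCATNeg (k : ℝ) {X : Type*} [MetricSpace X] (S : Set X) : Prop :=
  IsGeodesicSubset S ∧ SatisfiesComparison UpperHalfPlane (Real.sqrt k) S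

/-- `S`, with the induced metric, is locally CAT(0): each of its points is the centre of a ball of
`S` that is a CAT(0) space. -/
def IsLocallyCATZero {X : Type*} [MetricSpace X] (S : Set X) : Prop :=
  ∀ x ∈ S, ∃ r > 0, IsCATZero (S ∩ Metric.ball x r)

/-- `S`, with the induced metric, is locally CAT(-k): each of its points is the centre of a ball of
`S` that is a CAT(-k) space. -/
def IsLocallyCATNeg (k : ℝ) {X : Type*} [MetricSpace X] (S : Set X) : Prop :=
  ∀ x ∈ S, ∃ r > 0, IsCATNeg k (S ∩ Metric.ball x r)

/-- `X` is negatively curved around `Z`: for some neighbourhood `U` of `Z` and some `k > 0`, the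
complement of `Z` in `U` is locally CAT(-k). -/
def IsNegativelyCurvedAround {X : Type*} [MetricSpace X] (Z : Set X) : Prop :=
  ∃ U ∈ 𝓝ˢ Z, ∃ k > 0, IsLocallyCATNeg k (U \ Z)

/-- `H` is malnormal in `G`: `g H g⁻¹ ∩ H = 1` for every `g` outside `H`. -/
def IsMalnormal {G : Type*} [Group G] (H : Subgroup G) : Prop :=
  ∀ g : G, g ∉ H → H.map (MulAut.conj g).toMonoidHom ⊓ H = ⊥

/-- The homomorphism `π₁(Z, z) → π₁(X, z)` induced by the inclusion of a subspace `Z` in `X`. -/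
noncomputable def inclusionPiOne {X : Type*} [TopologicalSpace X] (Z : Set X) (z : Z) :
    FundamentalGroup Z z →* FundamentalGroup X (z : X) :=
  FundamentalGroup.map (⟨Subtype.val, continuous_subtype_val⟩ : C(Z, X)) z

/-! Loops are replaced by closed polygons with `N` vertices, at a uniform scale `ε` supplied by
compactness. At this scale midpoints exist and satisfy the CN inequality, in `X` and in `Z`, and
short paths with common ends are homotopic, so polygons have well-defined classes that survive small
moves. Birkhoff shortening replaces a polygon by the midpoints of its edges. It preserves `Z`, does
not increase the energy, and keeps polygons at distance at most `D` at distance at most `D`. Its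
accumulation points are closed geodesics, by the equality case of the energy estimate
(`chainEnergy_shorten_le`).

Cut a free homotopy into polygons `C j`, consecutive ones at distance at most `D`, shorten all of
them simultaneously and take limits along one common subsequence (`exists_limit`). Consecutive
limits are parallel closed geodesics. Summing CN and quadrilateral inequalities around the circle, a
discrete flat strip argument, gives them the same speed `a` and makes the triangles between them
Euclidean (`flat_of_isClosedGeodesic`).

Injectivity: if the homotopy ends at a constant loop, then `a = 0`, so the initial loop shrinks to a
point, through polygons in `Z`.

Malnormality: a relation `g a g⁻¹ = b` with `a`, `b` in the image and `a ≠ 1` is a free homotopy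
with track `g` between loops of `Z`. As the first loop is essential, `a > D` for a fine enough
subdivision. The limit of the first polygon lies in `Z`. If one limit lies in `Z`, a vertex of the
next one outside `Z` would be the apex of a nondegenerate flat triangle. Halving this triangle
towards its apex preserves flatness, but near the apex the CAT(-k) inequality makes the median
strictly shorter than the Euclidean one (`IsCATNeg.not_flat`). So all limits lie in `Z`, and so do
the vertices of the limiting track. Undoing the shortening moves the ends of the track only inside
`Z`, hence `g` lies in the image. -/

open scoped unitInterval
open Filter

/-! ### Euclidean comparison triangles -/

section ModelPlane

lemma euclidean_dist_pair (a b c d : ℝ) :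
    dist (!₂[a, b] : EuclideanSpace ℝ (Fin 2)) !₂[c, d] = √((a - c) ^ 2 + (b - d) ^ 2) := by
  rw [EuclideanSpace.dist_eq]
  simp [Fin.sum_univ_two, Real.dist_eq, sq_abs]

/-- A third vertex of a Euclidean triangle with prescribed side lengths. -/
lemma exists_third_vertex {a b c : ℝ} (ha : 0 ≤ a) (hab : a ≤ b + c) (hba : b ≤ a + c)
    (hc : c ≤ a + b) : ∃ u v : ℝ, u ^ 2 + v ^ 2 = b ^ 2 ∧ (a - u) ^ 2 + v ^ 2 = c ^ 2 := by
  rcases ha.eq_or_lt with rfl | ha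
  · have : b = c := by linarith
    exact ⟨b, 0, by ring, by rw [this]; ring⟩
  -- The law of cosines gives `u`, the foot of the altitude; `e` below is Heron's factorisation,
  -- whose factors are nonnegative by the triangle inequalities.
  · set u := (a ^ 2 + b ^ 2 - c ^ 2) / (2 * a) with hu
    have hu' : 2 * a * u = a ^ 2 + b ^ 2 - c ^ 2 := by rw [hu]; field_simp
    have hc0 : 0 ≤ c := by linarith
    have h1 : 0 ≤ b ^ 2 - u ^ 2 := by
      have e : (2 * a) ^ 2 * (b ^ 2 - u ^ 2) =
          ((a + b) ^ 2 - c ^ 2) * (c ^ 2 - (a - b) ^ 2) := by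
        have : (2 * a) ^ 2 * u ^ 2 = (a ^ 2 + b ^ 2 - c ^ 2) ^ 2 := by rw [← hu']; ring
        linear_combination - this
      have h2 : 0 ≤ ((a + b) ^ 2 - c ^ 2) * (c ^ 2 - (a - b) ^ 2) := by
        apply mul_nonneg
        · nlinarith
        · have := sq_le_sq' (a := a - b) (b := c) (by linarith) (by linarith)
          linarith
      rw [← e] at h2
      exact nonneg_of_mul_nonneg_right h2 (by positivity)
    refine ⟨u, √(b ^ 2 - u ^ 2), ?_, ?_⟩ <;> rw [Real.sq_sqrt h1]
    · ring
    · linear_combination -hu'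

end ModelPlane

/-! ### Geodesics, CAT(0) inequalities and subspaces -/

section Geodesics

variable {X : Type*} [MetricSpace X]

/-- The point that divides a geodesic in the ratio `t : 1 - t`. -/
lemma IsGeodesicSegment.exists_point {x y : X} {A : Set X} (h : IsGeodesicSegment x y A) {t : ℝ}
    (ht : t ∈ Set.Icc (0 : ℝ) 1) :
    ∃ u ∈ A, dist x u = t * dist x y ∧ dist u y = (1 - t) * dist x y := by
  obtain ⟨γ, h0, h1, hγ, rfl⟩ := h
  have hd : 0 ≤ dist x y := dist_nonneg
  have hm : t * dist x y ∈ Set.Icc 0 (dist x y) :=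
    ⟨mul_nonneg ht.1 hd, mul_le_of_le_one_left hd ht.2⟩
  refine ⟨γ (t * dist x y), ⟨_, hm, rfl⟩, ?_, ?_⟩
  · have := hγ 0 ⟨le_rfl, hd⟩ _ hm
    rw [h0] at this
    rw [this, zero_sub, abs_neg, abs_of_nonneg hm.1]
  · have := hγ _ hm _ ⟨hd, le_rfl⟩
    rw [h1] at this
    rw [this, abs_sub_comm, abs_of_nonneg (by linarith [hm.2])]
    ring

lemma IsGeodesicSegment.mem_ratio {x y u : X} {A : Set X} (h : IsGeodesicSegment x y A)
    (hu : u ∈ A) :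
    ∃ t ∈ Set.Icc (0 : ℝ) 1, dist x u = t * dist x y ∧ dist u y = (1 - t) * dist x y := by
  obtain ⟨γ, h0, h1, hγ, rfl⟩ := h
  obtain ⟨s, hs, rfl⟩ := hu
  have hd : 0 ≤ dist x y := dist_nonneg
  have e1 : dist x (γ s) = s := by
    have := hγ 0 ⟨le_rfl, hd⟩ _ hs
    rw [h0] at this
    rw [this, zero_sub, abs_neg, abs_of_nonneg hs.1]
  have e2 : dist (γ s) y = dist x y - s := by
    have := hγ _ hs _ ⟨hd, le_rfl⟩
    rw [h1] at this
    rw [this, abs_sub_comm, abs_of_nonneg (by linarith [hs.2])]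
  rcases hd.eq_or_lt with h | h
  · refine ⟨0, by simp, ?_, ?_⟩ <;> rw [← h] at hs <;> have := le_antisymm hs.2 hs.1
    · rw [e1, this]; simp
    · rw [e2, this]; simp
  · refine ⟨s / dist x y, ⟨by have := hs.1; positivity, by rw [div_le_one h]; exact hs.2⟩, ?_, ?_⟩
    · rw [e1]; field_simp
    · rw [e2]; field_simp

lemma IsGeodesicSegment.left_mem {x y : X} {A : Set X} (h : IsGeodesicSegment x y A) : x ∈ A := by
  obtain ⟨γ, h0, h1, hγ, rfl⟩ := h
  exact ⟨0, ⟨le_rfl, dist_nonneg⟩, h0⟩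

lemma IsGeodesicSegment.right_mem {x y : X} {A : Set X} (h : IsGeodesicSegment x y A) : y ∈ A := by
  obtain ⟨γ, h0, h1, hγ, rfl⟩ := h
  exact ⟨_, ⟨dist_nonneg, le_rfl⟩, h1⟩

/-- The comparison inequality of a CAT(0) space, as a polynomial in the side lengths. -/
lemma IsCATZero.dist_sq_le {S : Set X} (hS : IsCATZero S) {x p y u v : X} {A B : Set X}
    (hA : IsGeodesicSegment x p A) (hB : IsGeodesicSegment x y B) (hAS : A ⊆ S) (hBS : B ⊆ S)
    (hu : u ∈ A) (hv : v ∈ B) {s t : ℝ} (hs : s ∈ Set.Icc (0 : ℝ) 1) (ht : t ∈ Set.Icc (0 : ℝ) 1)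
    (hxu : dist x u = s * dist x p) (hup : dist u p = (1 - s) * dist x p)
    (hxv : dist x v = t * dist x y) (hvy : dist v y = (1 - t) * dist x y) :
    dist u v ^ 2 ≤ s ^ 2 * dist x p ^ 2 + t ^ 2 * dist x y ^ 2
      - s * t * (dist x p ^ 2 + dist x y ^ 2 - dist p y ^ 2) := by
  obtain ⟨C, hC, hCS⟩ := hS.1 p (hAS hA.right_mem) y (hBS hB.right_mem)
  obtain ⟨a, b, h1, h2⟩ := exists_third_vertex (a := dist x p) (b := dist x y) (c := dist p y)
    dist_nonneg (by rw [dist_comm p y]; exact dist_triangle _ _ _)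
    (dist_triangle _ _ _) (by rw [dist_comm x p]; exact dist_triangle _ _ _)
  have key := hS.2 x p y A B C hA hB hC hAS hBS hCS u hu v hv !₂[0, 0] !₂[dist x p, 0] !₂[a, b]
    !₂[s * dist x p, 0] !₂[t * a, t * b]
  simp only [euclidean_dist_pair, one_mul] at key
  have hs0 : 0 ≤ s := hs.1
  have hs1 : 0 ≤ 1 - s := by linarith [hs.2]
  have ht0 : 0 ≤ t := ht.1
  have ht1 : 0 ≤ 1 - t := by linarith [ht.2]
  have sqr : ∀ {z w : ℝ}, 0 ≤ w → z = w ^ 2 → √z = w := by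
    rintro z w hw rfl; exact Real.sqrt_sq hw
  have := key (sqr dist_nonneg (by ring)) (sqr dist_nonneg (by linear_combination h1))
    (sqr dist_nonneg (by linear_combination h2)) (sqr dist_nonneg (by rw [hxu]; ring))
    (sqr dist_nonneg (by rw [hup]; ring))
    (sqr dist_nonneg (by rw [hxv]; linear_combination t ^ 2 * h1))
    (sqr dist_nonneg (by rw [hvy]; linear_combination (1 - t) ^ 2 * h1))
  have h3 := pow_le_pow_left₀ dist_nonneg this 2
  rw [Real.sq_sqrt (by positivity)] at h3
  refine h3.trans (le_of_eq ?_)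
  linear_combination t ^ 2 * h1 - s * t * h1 + s * t * h2

/-- Distances from a point to the points of a geodesic. -/
lemma IsCATZero.dist_sq_le_of_mem {S : Set X} (hS : IsCATZero S) {x p y v : X} {B : Set X}
    (hp : p ∈ S) (hB : IsGeodesicSegment x y B) (hBS : B ⊆ S) (hv : v ∈ B) {t : ℝ}
    (ht : t ∈ Set.Icc (0 : ℝ) 1)
    (hxv : dist x v = t * dist x y) (hvy : dist v y = (1 - t) * dist x y) :
    dist p v ^ 2 ≤ (1 - t) * dist p x ^ 2 + t * dist p y ^ 2 - t * (1 - t) * dist x y ^ 2 := by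
  obtain ⟨A, hA, hAS⟩ := hS.1 x (hBS hB.left_mem) p hp
  refine (hS.dist_sq_le hA hB hAS hBS hA.right_mem hv (s := 1) (by simp) ht (by simp) (by simp)
    hxv hvy).trans (le_of_eq ?_)
  rw [dist_comm p x]
  ring

/-- A geodesic that stays in a subspace is a geodesic of the subspace. -/
lemma IsGeodesicSegment.preimage_val {Z : Set X} {x y : Z} {A : Set X}
    (h : IsGeodesicSegment (x : X) y A) (hA : A ⊆ Z) :
    IsGeodesicSegment x y (Subtype.val ⁻¹' A) := by
  classical
  obtain ⟨γ, h0, h1, hγ, rfl⟩ := h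
  have hm : ∀ s ∈ Set.Icc 0 (dist x y), γ s ∈ Z := fun s hs => hA ⟨s, hs, rfl⟩
  have h0m : (0 : ℝ) ∈ Set.Icc 0 (dist x y) := ⟨le_rfl, dist_nonneg⟩
  have h1m : dist x y ∈ Set.Icc 0 (dist x y) := ⟨dist_nonneg, le_rfl⟩
  have hval : ∀ s ∈ Set.Icc 0 (dist x y),
      ((if h : γ s ∈ Z then ⟨γ s, h⟩ else x : Z) : X) = γ s := fun s hs => by
    rw [dif_pos (hm s hs)]
  refine ⟨fun s => if h : γ s ∈ Z then ⟨γ s, h⟩ else x, ?_, ?_, ?_, ?_⟩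
  · exact Subtype.ext ((hval 0 h0m).trans h0)
  · exact Subtype.ext ((hval _ h1m).trans h1)
  · intro s hs t ht
    rw [Subtype.dist_eq, hval s hs, hval t ht]
    exact hγ s hs t ht
  · ext z
    constructor
    · rintro ⟨s, hs, hz⟩
      exact ⟨s, hs, Subtype.ext ((hval s hs).trans hz)⟩
    · rintro ⟨s, hs, rfl⟩
      exact ⟨s, hs, (hval s hs).symm⟩

/-- A geodesic of a subspace is a geodesic of the ambient space. -/
lemma IsGeodesicSegment.image_val {Z : Set X} {x y : Z} {A : Set Z}
    (h : IsGeodesicSegment x y A) : IsGeodesicSegment (x : X) y (Subtype.val '' A) := by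
  obtain ⟨γ, h0, h1, hγ, rfl⟩ := h
  exact ⟨fun s => γ s, by simp [h0], congrArg Subtype.val h1, hγ, by rw [Set.image_image]; rfl⟩

/-- A compact locally convex subspace of a locally CAT(0) space is locally CAT(0). -/
lemma IsLocallyConvex.isLocallyCATZero {Z : Set X}
    (hX : IsLocallyCATZero (Set.univ : Set X)) (hZ : IsLocallyConvex Z) :
    IsLocallyCATZero (Set.univ : Set Z) := by
  intro z _
  obtain ⟨r, hr, hS⟩ := hX z trivial
  obtain ⟨r', hr', hC⟩ := hZ z z.2
  rw [Set.univ_inter] at hS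
  refine ⟨min r r', lt_min hr hr', ?_⟩
  rw [Set.univ_inter]
  constructor
  · intro x hx y hy
    have hxr : dist (x : X) z < r := lt_of_lt_of_le hx (min_le_left _ _)
    have hyr : dist (y : X) z < r := lt_of_lt_of_le hy (min_le_left _ _)
    obtain ⟨A, hA, hAS⟩ := hS.1 x hxr y hyr
    have hxr' : dist (x : X) z < r' := lt_of_lt_of_le hx (min_le_right _ _)
    have hyr' : dist (y : X) z < r' := lt_of_lt_of_le hy (min_le_right _ _)
    have hAC := (hC x ⟨x.2, hxr'⟩ y ⟨y.2, hyr'⟩).2 A hA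
    refine ⟨_, hA.preimage_val (fun a ha => (hAC ha).1), ?_⟩
    intro v hv
    obtain ⟨t, ht, h1, h2⟩ := hA.mem_ratio hv
    -- Balls of a CAT(0) space are convex, so the geodesic stays in the smaller ball and not only in
    -- the one of radius `r`.
    have := hS.dist_sq_le_of_mem (p := z) (by simpa using hr) hA hAS hv ht h1 h2
    change dist (v : X) z < _
    rw [dist_comm]
    have hx' : dist (z : X) x < min r r' := by rw [dist_comm]; exact hx
    have hy' : dist (z : X) y < min r r' := by rw [dist_comm]; exact hy
    have ht0 : 0 ≤ t := ht.1
    have ht1 : 0 ≤ 1 - t := by linarith [ht.2]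
    have hM := max_lt hx' hy'
    refine lt_of_le_of_lt ?_ hM
    have hM0 : 0 ≤ max (dist (z : X) x) (dist (z : X) y) := le_max_of_le_left dist_nonneg
    refine abs_le_of_sq_le_sq' ?_ hM0 |>.2
    have e1 := mul_le_mul_of_nonneg_left
      (pow_le_pow_left₀ dist_nonneg (le_max_left (dist (z : X) x) (dist (z : X) y)) 2) ht1
    have e2 := mul_le_mul_of_nonneg_left
      (pow_le_pow_left₀ dist_nonneg (le_max_right (dist (z : X) x) (dist (z : X) y)) 2) ht0
    have e3 : 0 ≤ t * (1 - t) * dist (x : X) y ^ 2 := by positivity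
    linarith
  · have hsub : ∀ {A : Set Z}, A ⊆ Metric.ball z (min r r') →
        Subtype.val '' A ⊆ Metric.ball (z : X) r := by
      rintro A hA _ ⟨a, ha, rfl⟩
      exact lt_of_lt_of_le (show dist a z < min r r' from hA ha) (min_le_left _ _)
    intro p q r A B C hA hB hC hAS hBS hCS x hx y hy
    exact hS.2 p q r _ _ _ hA.image_val hB.image_val hC.image_val (hsub hAS) (hsub hBS) (hsub hCS)
      x ⟨x, hx, rfl⟩ y ⟨y, hy, rfl⟩

end Geodesics

/-! ### Geodesic contraction of CAT(0) balls -/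

section Contraction

variable {X : Type*} [MetricSpace X]

/-- A CAT(0) ball is contractible. -/
lemma IsCATZero.contractibleSpace {x : X} {r : ℝ} (hr : 0 < r)
    (hS : IsCATZero (Metric.ball x r)) : ContractibleSpace (Metric.ball x r) := by
  classical
  have hx : x ∈ Metric.ball x r := Metric.mem_ball_self hr
  choose A hA hAS using fun y : Metric.ball x r => hS.1 x hx y y.2
  choose u huA hu1 hu2 using fun (y : Metric.ball x r) (t : unitInterval) =>
    (hA y).exists_point t.2
  -- For equal ratios the comparison bound collapses to `(t * dist y y') ^ 2`; for `h2` the same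
  -- side is taken twice and only `(t - t') ^ 2` survives.
  have h1 : ∀ y y' t, dist (u y t) (u y' t) ≤ dist y y' := by
    intro y y' t
    have := hS.dist_sq_le (hA y) (hA y') (hAS y) (hAS y') (huA y t) (huA y' t) t.2 t.2
      (hu1 y t) (hu2 y t) (hu1 y' t) (hu2 y' t)
    have h2 : dist (u y t) (u y' t) ^ 2 ≤ ((t : ℝ) * dist (y : X) y') ^ 2 :=
      this.trans (le_of_eq (by ring))
    have h3 := (abs_le_of_sq_le_sq' h2 (mul_nonneg t.2.1 dist_nonneg)).2
    exact h3.trans (mul_le_of_le_one_left dist_nonneg t.2.2)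
  have h2 : ∀ y t t', dist (u y t) (u y t') ≤ r * dist t t' := by
    intro y t t'
    have := hS.dist_sq_le (hA y) (hA y) (hAS y) (hAS y) (huA y t) (huA y t') t.2 t'.2
      (hu1 y t) (hu2 y t) (hu1 y t') (hu2 y t')
    have h2 : dist (u y t) (u y t') ^ 2 ≤ (dist x (y : X) * dist t t') ^ 2 := by
      refine this.trans (le_of_eq ?_)
      rw [mul_pow, Subtype.dist_eq, Real.dist_eq, sq_abs, dist_self]
      ring
    have h3 := (abs_le_of_sq_le_sq' h2 (mul_nonneg dist_nonneg dist_nonneg)).2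
    refine h3.trans (mul_le_mul_of_nonneg_right ?_ dist_nonneg)
    rw [dist_comm]
    exact (show dist (y : X) x < r from y.2).le
  have hcont : Continuous fun p : unitInterval × Metric.ball x r => u p.2 p.1 := by
    rw [Metric.continuous_iff]
    intro ⟨t, y⟩ e he
    refine ⟨e / (r + 1), by positivity, fun ⟨t', y'⟩ h => ?_⟩
    rw [Prod.dist_eq, max_lt_iff] at h
    calc dist (u y' t') (u y t) ≤ dist (u y' t') (u y t') + dist (u y t') (u y t) :=
          dist_triangle _ _ _
      _ ≤ dist y' y + r * dist t' t := add_le_add (h1 _ _ _) (h2 _ _ _)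
      _ < e / (r + 1) + r * (e / (r + 1)) :=
          add_lt_add h.2 (mul_lt_mul_of_pos_left h.1 hr)
      _ = e := by field_simp; ring
  rw [contractible_iff_id_nullhomotopic]
  refine ⟨⟨x, hx⟩, ⟨ContinuousMap.Homotopy.symm ⟨⟨fun p => ⟨u p.2 p.1, hAS _ (huA _ _)⟩,
    hcont.subtype_mk _⟩, ?_, ?_⟩⟩⟩
  · intro y
    apply Subtype.ext
    have := hu1 y 0
    simp only [Set.Icc.coe_zero, zero_mul, dist_eq_zero] at this
    simp [← this]
  · intro y
    apply Subtype.ext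
    have := hu2 y 1
    simp only [Set.Icc.coe_one, sub_self, zero_mul, dist_eq_zero] at this
    simp [this]

end Contraction

/-! ### Uniform scales from compactness -/

section UniformScale

/-- At the scale `ε`, paths with the same end points are homotopic and close points are joined by
short paths. -/
structure IsSimplyConnectedAtScale (Y : Type*) [MetricSpace Y] (ε : ℝ) : Prop where
  exists_path : ∀ x y : Y, dist x y < ε → ∃ γ : Path x y, ∀ t, dist x (γ t) ≤ dist x y
  homotopic : ∀ x a b : Y, ∀ γ γ' : Path a b, (∀ t, dist x (γ t) < 3 * ε) →
    (∀ t, dist x (γ' t) < 3 * ε) → γ.Homotopic γ'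

/-- `mid x y` is a midpoint of `x` and `y`, for points at distance less than `ε`, that satisfies
the CN inequality of Bruhat and Tits. -/
structure IsMidpointMap {Y : Type*} [MetricSpace Y] (ε : ℝ) (mid : Y → Y → Y) : Prop where
  dist_left : ∀ {x y : Y}, dist x y < ε → dist x (mid x y) = dist x y / 2
  dist_right : ∀ {x y : Y}, dist x y < ε → dist (mid x y) y = dist x y / 2
  cn : ∀ {x y p : Y}, dist x y < ε → dist p x < ε →
    4 * dist p (mid x y) ^ 2 + dist x y ^ 2 ≤ 2 * dist p x ^ 2 + 2 * dist p y ^ 2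

variable {Y : Type*} [MetricSpace Y]

lemma IsGeodesicSegment.exists_path {x y : Y} {A : Set Y} (h : IsGeodesicSegment x y A) :
    ∃ γ : Path x y, ∀ t, dist x (γ t) ≤ dist x y := by
  have hA := h
  obtain ⟨γ, h0, h1, hγ, rfl⟩ := h
  have hm : ∀ t : unitInterval, (t : ℝ) * dist x y ∈ Set.Icc 0 (dist x y) := fun t =>
    ⟨mul_nonneg t.2.1 dist_nonneg, mul_le_of_le_one_left dist_nonneg t.2.2⟩
  refine ⟨⟨⟨fun t => γ (t * dist x y), ?_⟩, by simpa using h0, by simpa using h1⟩, ?_⟩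
  · rw [Metric.continuous_iff]
    intro t e he
    refine ⟨e / (dist x y + 1), by positivity, fun t' h => ?_⟩
    rw [hγ _ (hm t') _ (hm t), ← sub_mul, abs_mul, abs_of_nonneg (dist_nonneg (x := x) (y := y)),
      ← Real.dist_eq, ← Subtype.dist_eq]
    rw [lt_div_iff₀ (by positivity)] at h
    nlinarith [dist_nonneg (x := t') (y := t)]
  · intro t
    obtain ⟨s, hs, e1, -⟩ := hA.mem_ratio ⟨_, hm t, rfl⟩
    change dist x (γ (t * dist x y)) ≤ _
    rw [e1]
    exact mul_le_of_le_one_left dist_nonneg hs.2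

lemma homotopic_of_forall_mem {S : Set Y} [ContractibleSpace S] {a b : Y} (γ γ' : Path a b)
    (h : ∀ t, γ t ∈ S) (h' : ∀ t, γ' t ∈ S) : γ.Homotopic γ' := by
  have ha : a ∈ S := by simpa using h 0
  have hb : b ∈ S := by simpa using h 1
  let δ : Path (⟨a, ha⟩ : S) ⟨b, hb⟩ :=
    ⟨⟨fun t => ⟨γ t, h t⟩, γ.continuous.subtype_mk _⟩, by simp, by simp⟩
  let δ' : Path (⟨a, ha⟩ : S) ⟨b, hb⟩ :=
    ⟨⟨fun t => ⟨γ' t, h' t⟩, γ'.continuous.subtype_mk _⟩, by simp, by simp⟩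
  exact (SimplyConnectedSpace.paths_homotopic δ δ').map ⟨Subtype.val, continuous_subtype_val⟩

variable [CompactSpace Y]

/-- A Lebesgue number of the cover by CAT(0) balls. The centre `z` differs from `x` in general: the
small ball is only contained in a CAT(0) ball. -/
lemma IsLocallyCATZero.exists_scale (hY : IsLocallyCATZero (Set.univ : Set Y)) :
    ∃ ε > 0, ∀ x : Y, ∃ z : Y, ∃ r > 0, Metric.ball x ε ⊆ Metric.ball z r ∧
      IsCATZero (Metric.ball z r) := by
  choose r hr hS using fun x => hY x trivial
  obtain ⟨ε, hε, h⟩ := lebesgue_number_lemma_of_metric (s := (Set.univ : Set Y)) isCompact_univ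
    (c := fun x => Metric.ball x (r x)) (fun x => Metric.isOpen_ball)
    (fun x _ => Set.mem_iUnion.2 ⟨x, Metric.mem_ball_self (hr x)⟩)
  refine ⟨ε, hε, fun x => ?_⟩
  obtain ⟨z, hz⟩ := h x trivial
  exact ⟨z, r z, hr z, hz, by simpa using hS z⟩

lemma IsLocallyCATZero.exists_isSimplyConnectedAtScale
    (hY : IsLocallyCATZero (Set.univ : Set Y)) :
    ∃ ε > 0, IsSimplyConnectedAtScale Y ε := by
  obtain ⟨ε, hε, h⟩ := hY.exists_scale
  -- The homotopy condition concerns balls of three times the scale, which leaves room for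
  -- concatenating edges.
  refine ⟨ε / 3, by positivity, ⟨fun x y hxy => ?_, fun x a b γ γ' h1 h2 => ?_⟩⟩
  · obtain ⟨z, r, hr, hz, hS⟩ := h x
    obtain ⟨A, hA, -⟩ := hS.1 x (hz (Metric.mem_ball_self hε)) y
      (hz (by rw [Metric.mem_ball, dist_comm]; linarith))
    exact hA.exists_path
  · obtain ⟨z, r, hr, hz, hS⟩ := h x
    have := hS.contractibleSpace hr
    apply homotopic_of_forall_mem (S := Metric.ball z r)
    · exact fun t => hz (by rw [Metric.mem_ball, dist_comm]; linarith [h1 t])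
    · exact fun t => hz (by rw [Metric.mem_ball, dist_comm]; linarith [h2 t])

/-- CN is the comparison inequality at `t = 1 / 2`; all points involved lie in one CAT(0) ball
containing the `ε`-ball around `x`. -/
lemma IsLocallyCATZero.exists_isMidpointMap (hY : IsLocallyCATZero (Set.univ : Set Y)) :
    ∃ ε > 0, ∃ mid : Y → Y → Y, IsMidpointMap ε mid := by
  obtain ⟨ε, hε, h⟩ := hY.exists_scale
  have key : ∀ x y : Y, ∃ m, dist x y < ε → dist x m = dist x y / 2 ∧ dist m y = dist x y / 2 ∧
      ∀ p, dist p x < ε →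
        4 * dist p m ^ 2 + dist x y ^ 2 ≤ 2 * dist p x ^ 2 + 2 * dist p y ^ 2 := by
    intro x y
    by_cases hxy : dist x y < ε
    · obtain ⟨z, r, hr, hz, hS⟩ := h x
      obtain ⟨B, hB, hBS⟩ := hS.1 x (hz (Metric.mem_ball_self hε)) y
        (hz (by rwa [Metric.mem_ball, dist_comm]))
      have ht : (1 / 2 : ℝ) ∈ Set.Icc (0 : ℝ) 1 := by norm_num
      obtain ⟨m, hm, h1, h2⟩ := hB.exists_point ht
      refine ⟨m, fun _ => ⟨by rw [h1]; ring, by rw [h2]; ring, fun p hp => ?_⟩⟩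
      have := hS.dist_sq_le_of_mem (hz (by rwa [Metric.mem_ball])) hB hBS hm ht h1 h2 (p := p)
      linarith
    -- A default value beyond the scale.
    · exact ⟨x, fun h => absurd h hxy⟩
  choose mid hmid using key
  exact ⟨ε, hε, mid, ⟨fun h => (hmid _ _ h).1, fun h => (hmid _ _ h).2.1,
    fun h hp => (hmid _ _ h).2.2 _ hp⟩⟩

end UniformScale

/-! ### Hyperbolic medians are shorter than Euclidean ones -/

section HyperbolicPlane

/-- Strict convexity of `t ↦ cosh √t`, in the form of an inequality for the sides and the median
of a triangle. -/
lemma cosh_add_cosh_lt {b c₁ c₂ h : ℝ} (hh : 0 ≤ h) (hb : 0 < b)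
    (hmed : c₁ ^ 2 + c₂ ^ 2 = 2 * h ^ 2 + 2 * b ^ 2) (h1 : 2 * b < c₁ + c₂)
    (h2 : |c₁ - c₂| < 2 * b) :
    Real.cosh c₁ + Real.cosh c₂ < 2 * (Real.cosh h * Real.cosh b) := by
  have hP : (2 * b) ^ 2 < (c₁ + c₂) ^ 2 := by nlinarith
  have hQ : (c₁ - c₂) ^ 2 < (2 * b) ^ 2 := by
    rw [← sq_abs (c₁ - c₂)]
    exact pow_lt_pow_left₀ h2 (abs_nonneg _) (by norm_num)
  have hh0 : 0 < h := by
    rcases hh.eq_or_lt with rfl | h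
    · nlinarith [sq_nonneg (c₁ - c₂)]
    · exact h
  have hd : (c₁ ^ 2 - c₂ ^ 2) ^ 2 < (4 * h * b) ^ 2 := by
    have e : (4 * h * b) ^ 2 - (c₁ ^ 2 - c₂ ^ 2) ^ 2 =
        ((c₁ + c₂) ^ 2 - (2 * b) ^ 2) * ((2 * b) ^ 2 - (c₁ - c₂) ^ 2) := by
      linear_combination (-8 * b ^ 2) * hmed
    have := mul_pos (sub_pos.2 hP) (sub_pos.2 hQ)
    linarith
  have hd' := abs_lt_of_sq_lt_sq hd (by positivity)
  rw [abs_lt] at hd'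
  -- `c₁ ^ 2` and `c₂ ^ 2` have the sum `A + B` and, by `hd'`, lie strictly between `B` and `A`.
  -- Convexity of powers compares the series of `cosh` term by term, strictly at `n = 2`; the
  -- addition formulas rewrite the right side.
  set A := (h + b) ^ 2 with hA
  set B := (h - b) ^ 2 with hB
  have hAB : A - B = 4 * h * b := by rw [hA, hB]; ring
  have hAB0 : 0 < A - B := by rw [hAB]; positivity
  have hsum : c₁ ^ 2 + c₂ ^ 2 = A + B := by rw [hA, hB, hmed]; ring
  obtain ⟨l, hl0, hl1, hl⟩ : ∃ l : ℝ, 0 < l ∧ l < 1 ∧ c₁ ^ 2 = l * A + (1 - l) * B := by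
    refine ⟨(c₁ ^ 2 - B) / (A - B), div_pos (by linarith) hAB0,
      (div_lt_one hAB0).2 (by linarith), ?_⟩
    field_simp
    ring
  have hl' : c₂ ^ 2 = (1 - l) * A + l * B := by linarith
  have hterm : ∀ n : ℕ, (c₁ ^ 2) ^ n + (c₂ ^ 2) ^ n ≤ A ^ n + B ^ n := by
    intro n
    have hc := (convexOn_pow (𝕜 := ℝ) n).2 (x := A) (by simp only [Set.mem_Ici]; positivity)
      (y := B) (by simp only [Set.mem_Ici]; positivity)
    have e1 := hc hl0.le (by linarith : 0 ≤ 1 - l) (by ring)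
    have e2 := hc (by linarith : 0 ≤ 1 - l) hl0.le (by ring)
    simp only [smul_eq_mul] at e1 e2
    rw [hl, hl']
    linarith
  have hterm2 : (c₁ ^ 2) ^ 2 + (c₂ ^ 2) ^ 2 < A ^ 2 + B ^ 2 := by
    have : 0 < 2 * (l * (1 - l)) * (A - B) ^ 2 := by
      have : 0 < 1 - l := by linarith
      positivity
    rw [hl, hl']
    nlinarith
  have hs1 := (Real.hasSum_cosh c₁).add (Real.hasSum_cosh c₂)
  have hs2 := (Real.hasSum_cosh (h + b)).add (Real.hasSum_cosh (h - b))
  have hprod : Real.cosh (h + b) + Real.cosh (h - b) = 2 * (Real.cosh h * Real.cosh b) := by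
    rw [Real.cosh_add, Real.cosh_sub]; ring
  rw [← hprod]
  refine hasSum_lt (i := 2) (fun n => ?_) ?_ hs1 hs2
  · simp only [pow_mul, ← add_div]
    exact div_le_div_of_nonneg_right (hterm n) (by positivity)
  · simp only [pow_mul, ← add_div]
    exact div_lt_div_of_pos_right hterm2 (by positivity)

lemma UpperHalfPlane.dist_eq_of_cosh {z w : UpperHalfPlane} {d : ℝ} (hd : 0 ≤ d)
    (h : ((z.re - w.re) ^ 2 + (z.im - w.im) ^ 2) / (2 * z.im * w.im) = Real.cosh d - 1) :
    dist z w = d := by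
  have h1 := UpperHalfPlane.cosh_dist z w
  have h2 : dist (z : ℂ) w ^ 2 = (z.re - w.re) ^ 2 + (z.im - w.im) ^ 2 := by
    rw [Complex.dist_eq_re_im, Real.sq_sqrt (by positivity)]
    rfl
  rw [h2, h] at h1
  have h3 : Real.cosh (dist z w) = Real.cosh d := by linarith
  exact Real.cosh_strictMonoOn.injOn dist_nonneg hd h3

/-- In the hyperbolic plane, a nondegenerate triangle with sides `c₁`, `c₂`, `2b` has a shorter
median than the Euclidean one. -/
lemma UpperHalfPlane.exists_triangle_dist_lt {b c₁ c₂ h : ℝ} (hh : 0 ≤ h) (hb : 0 < b)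
    (hc₁ : 0 ≤ c₁) (hc₂ : 0 ≤ c₂)
    (hmed : c₁ ^ 2 + c₂ ^ 2 = 2 * h ^ 2 + 2 * b ^ 2) (h1 : 2 * b < c₁ + c₂)
    (h2 : |c₁ - c₂| < 2 * b) :
    ∃ q p r m : UpperHalfPlane, dist p q = c₁ ∧ dist q r = c₂ ∧ dist p r = 2 * b ∧
      dist p m = b ∧ dist m r = b ∧ dist q m < h := by
  have hlt := cosh_add_cosh_lt hh hb hmed h1 h2
  -- The base runs along the imaginary axis from `iE` to `i/E`, with midpoint `i`. With `y` the
  -- height and `ρ` the squared modulus of the apex, the two side lengths become the linear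
  -- equations `eq1` and `eq2`; the triangle inequalities give `y ^ 2 ≤ ρ`.
  set E := Real.exp b with hE
  have hE0 : 0 < E := Real.exp_pos b
  set C₁ := Real.cosh c₁ with hC₁
  set C₂ := Real.cosh c₂ with hC₂
  have hcb : Real.cosh b = (E + E⁻¹) / 2 := by rw [Real.cosh_eq, Real.exp_neg]
  have hE2 : Real.exp (2 * b) = E ^ 2 := by rw [two_mul, Real.exp_add, hE]; ring
  have hc2b : Real.cosh (2 * b) = (E ^ 2 + (E ^ 2)⁻¹) / 2 := by
    rw [Real.cosh_eq, Real.exp_neg, hE2]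
  have hs2b : Real.sinh (2 * b) = (E ^ 2 - (E ^ 2)⁻¹) / 2 := by
    rw [Real.sinh_eq, Real.exp_neg, hE2]
  set S := Real.sinh (2 * b) with hS
  have hS0 : 0 < S := Real.sinh_pos_iff.2 (by linarith)
  rw [abs_lt] at h2
  have hup : C₂ ≤ Real.cosh (2 * b) * C₁ + S * Real.sinh c₁ := by
    rw [hS, hC₁, ← Real.cosh_add, hC₂, Real.cosh_le_cosh, abs_of_nonneg hc₂,
      abs_of_nonneg (by linarith)]
    linarith
  have hlow : Real.cosh (2 * b) * C₁ - S * Real.sinh c₁ ≤ C₂ := by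
    rw [hS, hC₁, ← Real.cosh_sub, hC₂, Real.cosh_le_cosh, abs_of_nonneg hc₂, abs_le]
    constructor <;> linarith
  have hC₁0 : 0 < C₁ := Real.cosh_pos _
  have hsc : Real.sinh c₁ < C₁ := Real.sinh_lt_cosh _
  have hsq : C₁ ^ 2 = Real.sinh c₁ ^ 2 + 1 := Real.cosh_sq c₁
  -- `W = E² C₁ - C₂`, and the apex has imaginary part `S E / W`
  set W := E ^ 2 * C₁ - C₂ with hW
  have hW0 : 0 < W := by
    have e : E ^ 2 = Real.cosh (2 * b) + S := by rw [hc2b, hs2b]; ring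
    have : S * Real.sinh c₁ < S * C₁ := mul_lt_mul_of_pos_left hsc hS0
    rw [hW, e]; linarith
  set y := S * E / W with hy
  have hy0 : 0 < y := by positivity
  set ρ := 2 * y * E * C₁ - E ^ 2 with hρ
  have hρy : 0 ≤ ρ - y ^ 2 := by
    have e1 : W ^ 2 * (ρ - y ^ 2) = E ^ 2 * (S ^ 2 * Real.sinh c₁ ^ 2 - (W - S * C₁) ^ 2) := by
      rw [hρ, hy]
      field_simp
      linear_combination S ^ 2 * hsq
    have e2 : W - S * C₁ = Real.cosh (2 * b) * C₁ - C₂ := by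
      rw [hW, hc2b, hs2b]; ring
    have e3 : (W - S * C₁) ^ 2 ≤ (S * Real.sinh c₁) ^ 2 := by
      rw [e2]; exact sq_le_sq' (by linarith) (by linarith)
    have e4 : 0 ≤ W ^ 2 * (ρ - y ^ 2) := by
      rw [e1]; exact mul_nonneg (by positivity) (by nlinarith)
    exact nonneg_of_mul_nonneg_right e4 (by positivity)
  have hsqrt := Real.sq_sqrt hρy
  have eq1 : ρ + E ^ 2 = 2 * y * E * C₁ := by rw [hρ]; ring
  have eq2 : ρ * E ^ 2 + 1 = 2 * y * E * C₂ := by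
    have hyW : y * W = S * E := by rw [hy]; field_simp
    have e5 : 2 * S * E ^ 2 = E ^ 4 - 1 := by rw [hs2b]; field_simp
    rw [hρ]
    have : E ^ 2 * C₁ = W + C₂ := by rw [hW]; ring
    linear_combination (2 * y * E) * this + 2 * E * hyW + e5
  refine ⟨⟨⟨√(ρ - y ^ 2), y⟩, hy0⟩, ⟨⟨0, E⟩, hE0⟩, ⟨⟨0, E⁻¹⟩, inv_pos.2 hE0⟩, ⟨⟨0, 1⟩, one_pos⟩,
    ?_, ?_, ?_, ?_, ?_, ?_⟩
  · apply UpperHalfPlane.dist_eq_of_cosh hc₁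
    change ((0 - √(ρ - y ^ 2)) ^ 2 + (E - y) ^ 2) / (2 * E * y) = C₁ - 1
    rw [zero_sub, neg_sq, hsqrt, div_eq_iff (by positivity)]
    linear_combination eq1
  · apply UpperHalfPlane.dist_eq_of_cosh hc₂
    change ((√(ρ - y ^ 2) - 0) ^ 2 + (y - E⁻¹) ^ 2) / (2 * y * E⁻¹) = C₂ - 1
    rw [sub_zero, hsqrt, div_eq_iff (by positivity)]
    field_simp
    linear_combination eq2
  · apply UpperHalfPlane.dist_eq_of_cosh (by positivity)
    change ((0 - 0) ^ 2 + (E - E⁻¹) ^ 2) / (2 * E * E⁻¹) = _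
    rw [hc2b]
    field_simp
    ring
  · apply UpperHalfPlane.dist_eq_of_cosh hb.le
    change ((0 - 0) ^ 2 + (E - 1) ^ 2) / (2 * E * 1) = _
    rw [hcb]
    field_simp
    ring
  · apply UpperHalfPlane.dist_eq_of_cosh hb.le
    change ((0 - 0) ^ 2 + (1 - E⁻¹) ^ 2) / (2 * 1 * E⁻¹) = _
    rw [hcb]
    field_simp
    ring
  · rw [← abs_of_nonneg hh, ← abs_of_nonneg (dist_nonneg (x := _) (y := _)), ← Real.cosh_lt_cosh,
      UpperHalfPlane.cosh_dist]
    have h2 : dist ((⟨⟨√(ρ - y ^ 2), y⟩, hy0⟩ : UpperHalfPlane) : ℂ)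
        ((⟨⟨0, 1⟩, one_pos⟩ : UpperHalfPlane) : ℂ) ^ 2 = (ρ - y ^ 2) + (y - 1) ^ 2 := by
      rw [Complex.dist_eq_re_im, Real.sq_sqrt (by positivity)]
      change (√(ρ - y ^ 2) - 0) ^ 2 + (y - 1) ^ 2 = _
      rw [sub_zero, hsqrt]
    rw [h2]
    change 1 + (ρ - y ^ 2 + (y - 1) ^ 2) / (2 * y * 1) < _
    -- The hyperbolic median formula: `cosh` of the median is `(C₁ + C₂) / (2 cosh b)`.
    have h3 : 1 + (ρ - y ^ 2 + (y - 1) ^ 2) / (2 * y * 1) = (C₁ + C₂) / (2 * Real.cosh b) := by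
      rw [hcb]
      field_simp
      linear_combination eq1 + eq2
    rw [h3, div_lt_iff₀ (by have := Real.cosh_pos b; positivity)]
    linarith

end HyperbolicPlane

/-! ### Consequences of the CN inequality -/

namespace IsMidpointMap

variable {X : Type*} [MetricSpace X] {ε : ℝ} {mid : X → X → X}

/-- CN applied to `p = m` leaves no room for a positive distance between `m` and `mid x y`. -/
lemma eq_mid (hm : IsMidpointMap ε mid) {x y m : X} (hxy : dist x y < ε)
    (h1 : dist x m ≤ dist x y / 2) (h2 : dist m y ≤ dist x y / 2) : m = mid x y := by
  have h0 := dist_nonneg (x := x) (y := y)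
  have h3 := hm.cn hxy (p := m) (by rw [dist_comm]; linarith)
  rw [dist_comm m x] at h3
  have h4 := pow_le_pow_left₀ dist_nonneg h1 2
  have h5 := pow_le_pow_left₀ dist_nonneg h2 2
  have h6 : dist m (mid x y) ^ 2 = 0 :=
    le_antisymm (by nlinarith) (sq_nonneg _)
  exact dist_eq_zero.1 (pow_eq_zero_iff (by norm_num) |>.1 h6)

/-- The quadrilateral inequality. -/
lemma quadrilateral (hm : IsMidpointMap ε mid) {a b c d : X} (hac : dist a c < ε)
    (hba : dist b a < ε) (hda : dist d a < ε) :
    dist a c ^ 2 + dist b d ^ 2 ≤ dist a b ^ 2 + dist b c ^ 2 + dist c d ^ 2 + dist d a ^ 2 := by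
  have h1 := hm.cn hac hba
  have h2 := hm.cn hac hda
  have h3 := dist_triangle_right b d (mid a c)
  have h4 := pow_le_pow_left₀ dist_nonneg h3 2
  rw [dist_comm a b, dist_comm c d]
  nlinarith [sq_nonneg (dist b (mid a c) - dist d (mid a c))]

/-- Three CN inequalities and the quadrilateral inequality add up to this. It makes shortening
non-expanding and `mid` continuous. -/
lemma dist_mid_mid_sq_le (hm : IsMidpointMap ε mid) {x y x' y' : X} (hxy : dist x y < ε / 3)
    (hxy' : dist x' y' < ε / 3) (hx : dist x x' < ε / 3) :
    2 * dist (mid x y) (mid x' y') ^ 2 ≤ dist x x' ^ 2 + dist y y' ^ 2 := by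
  have hε : 0 < ε := by linarith [dist_nonneg.trans_lt hxy]
  have hl := hm.dist_left (x := x) (y := y) (by linarith)
  have t1 := dist_triangle (mid x y) x x'
  have t2 := dist_triangle x x' y'
  have h1 := hm.cn (p := mid x y) (x := x') (y := y') (by linarith)
    (by rw [dist_comm x] at hl; linarith [dist_nonneg (x := x) (y := y)])
  have h2 := hm.cn (p := x') (x := x) (y := y) (by linarith) (by rw [dist_comm]; linarith)
  have h3 := hm.cn (p := y') (x := x) (y := y) (by linarith) (by rw [dist_comm]; linarith)
  have h4 := hm.quadrilateral (a := x) (b := x') (c := y') (d := y) (by linarith)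
    (by rw [dist_comm]; linarith) (by rw [dist_comm]; linarith)
  simp only [dist_comm x' x, dist_comm y' y, dist_comm y x, dist_comm y' x, dist_comm x' (mid x y),
    dist_comm y' (mid x y)] at *
  linarith

/-- The midline is at most half the base, by CN twice; this is why shortening does not increase the
energy. -/
lemma dist_mid_mid_le_half (hm : IsMidpointMap ε mid) {x y z : X} (hxy : dist x y < ε / 3)
    (hyz : dist y z < ε / 3) : 2 * dist (mid x y) (mid y z) ≤ dist x z := by
  have hε : 0 < ε := by linarith [dist_nonneg.trans_lt hxy]
  have hr := hm.dist_right (x := x) (y := y) (by linarith)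
  have t := dist_triangle x y z
  have h1 := hm.cn (p := mid x y) (x := y) (y := z) (by linarith)
    (by linarith [dist_nonneg (x := x) (y := y)])
  have h2 := hm.cn (p := z) (x := x) (y := y) (by linarith) (by rw [dist_comm]; linarith)
  rw [hr] at h1
  simp only [dist_comm z x, dist_comm z y, dist_comm z (mid x y)] at *
  have h3 : (2 * dist (mid x y) (mid y z)) ^ 2 ≤ dist x z ^ 2 := by nlinarith
  exact (abs_le_of_sq_le_sq' h3 dist_nonneg).2

/-- A midpoint formed in `Z` is also one in `X`, where midpoints are unique. -/
lemma mem_of_mem {Z : Set X} {ε' : ℝ} {mid' : Z → Z → Z} (hm : IsMidpointMap ε mid)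
    (hm' : IsMidpointMap ε' mid') {x y : X} (hx : x ∈ Z) (hy : y ∈ Z) (h : dist x y < ε)
    (h' : dist x y < ε') : mid x y ∈ Z := by
  have h1 := hm'.dist_left (x := ⟨x, hx⟩) (y := ⟨y, hy⟩) h'
  have h2 := hm'.dist_right (x := ⟨x, hx⟩) (y := ⟨y, hy⟩) h'
  rw [← hm.eq_mid (m := mid' ⟨x, hx⟩ ⟨y, hy⟩) h h1.le h2.le]
  exact Subtype.coe_prop _

end IsMidpointMap

/-! ### Flat triangles and negative curvature -/

section FlatTriangles

variable {X : Type*} [MetricSpace X] {ε : ℝ} {mid : X → X → X}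

/-- A triangle with apex `q` and sides `c₁`, `c₂`, `2b`, in which `m` is the midpoint of the base
and the median has length `h`. -/
structure IsTriangleWithMedian (q p r m : X) (c₁ c₂ b h : ℝ) : Prop where
  left : dist p q = c₁
  right : dist q r = c₂
  base : dist p r = 2 * b
  base_left : dist p m = b
  base_right : dist m r = b
  median : dist q m = h

/-- Here `e` is the midline `p' r'` with midpoint `m'`, `v` and `u` are the distances from `m'` to
`q` and `m`, `A` is `p r'`, and `D₁`, `D₂` are the distances from `m` to `p'`, `r'`. The hypotheses
bound `4 * (u ^ 2 + v ^ 2)` by `2 * h ^ 2`, while `h ≤ u + v`; so `u = v` and equality holds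
throughout. -/
lemma eq_of_flat_inequalities {c₁ c₂ b h e u v A D₁ D₂ : ℝ} (hh0 : 0 ≤ h) (hb0 : 0 ≤ b)
    (he0 : 0 ≤ e) (hv0 : 0 ≤ v) (hflat : c₁ ^ 2 + c₂ ^ 2 = 2 * h ^ 2 + 2 * b ^ 2)
    (e1 : 4 * v ^ 2 + e ^ 2 ≤ 2 * (c₁ / 2) ^ 2 + 2 * (c₂ / 2) ^ 2)
    (e2 : 4 * u ^ 2 + e ^ 2 ≤ 2 * D₁ ^ 2 + 2 * D₂ ^ 2)
    (e3 : 4 * D₂ ^ 2 + (2 * b) ^ 2 ≤ 2 * A ^ 2 + 2 * (c₂ / 2) ^ 2)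
    (e4 : A ^ 2 + D₁ ^ 2 ≤ (c₁ / 2) ^ 2 + e ^ 2 + D₂ ^ 2 + b ^ 2)
    (e6 : h ^ 2 ≤ (v + u) ^ 2) : e = b ∧ v = h / 2 := by
  have i1 : 4 * v ^ 2 ≤ h ^ 2 + b ^ 2 - e ^ 2 := by linarith
  have i2 : 4 * u ^ 2 ≤ h ^ 2 + e ^ 2 - b ^ 2 := by linarith
  have e7 : (u - v) ^ 2 ≤ 0 := by linarith
  have huv : u = v := by
    have := pow_eq_zero_iff (two_ne_zero) |>.1 (le_antisymm e7 (sq_nonneg (u - v)))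
    linarith
  subst huv
  have e8 : e ^ 2 = b ^ 2 := by linarith
  have e9 : (2 * u) ^ 2 = h ^ 2 := by linarith
  have h1 := (sq_eq_sq₀ he0 hb0).1 e8
  have h2 := (sq_eq_sq₀ (by positivity) hh0).1 e9
  exact ⟨h1, by linarith⟩

/-- If the median of a triangle is as long as in the Euclidean plane, then the homothetic triangle
of half the size has the same property. -/
lemma IsTriangleWithMedian.exists_half (hm : IsMidpointMap ε mid) {q p r m : X} {c₁ c₂ b h : ℝ}
    (ht : IsTriangleWithMedian q p r m c₁ c₂ b h)
    (hflat : c₁ ^ 2 + c₂ ^ 2 = 2 * h ^ 2 + 2 * b ^ 2)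
    (hc₁ : c₁ < ε / 4) (hc₂ : c₂ < ε / 4) (hb : b < ε / 4) :
    ∃ p' r' m', IsTriangleWithMedian q p' r' m' (c₁ / 2) (c₂ / 2) (b / 2) (h / 2) := by
  have hc₁0 : 0 ≤ c₁ := ht.left ▸ dist_nonneg
  have hc₂0 : 0 ≤ c₂ := ht.right ▸ dist_nonneg
  have hb0 : 0 ≤ b := ht.base_left ▸ dist_nonneg
  have hh0 : 0 ≤ h := ht.median ▸ dist_nonneg
  obtain ⟨a1, a2, a3, a4, a5, a6⟩ := ht
  have hhle : h ≤ c₁ + b := by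
    rw [← a6, ← a1, ← a4, dist_comm p q]; exact dist_triangle _ _ _
  have hqp : dist q p < ε := by rw [dist_comm]; linarith
  have hqr : dist q r < ε := by linarith
  set p' := mid p q with hp'
  set r' := mid q r with hr'
  have p1 : dist p p' = c₁ / 2 := by rw [hm.dist_left (by linarith), a1]
  have p2 : dist p' q = c₁ / 2 := by rw [hm.dist_right (by linarith), a1]
  have r1 : dist q r' = c₂ / 2 := by rw [hm.dist_left (by linarith), a2]
  have r2 : dist r' r = c₂ / 2 := by rw [hm.dist_right (by linarith), a2]
  set e := dist p' r' with he
  have he1 : e ≤ c₁ / 2 + c₂ / 2 := by rw [he, ← p2, ← r1]; exact dist_triangle _ _ _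
  have he0 : 0 ≤ e := dist_nonneg
  have hmm : m = mid p r := hm.eq_mid (by linarith) (by linarith) (by linarith)
  set m' := mid p' r' with hm'
  have m1 : dist p' m' = e / 2 := hm.dist_left (by linarith)
  have m2 : dist m' r' = e / 2 := hm.dist_right (by linarith)
  have hmp' : dist m p' < ε := by
    have := dist_triangle m q p'
    rw [dist_comm m q, a6, dist_comm q p', p2] at this
    linarith
  have hr'p : dist r' p < ε := by
    have := dist_triangle r' q p
    rw [dist_comm r' q, r1, dist_comm q p, a1] at this
    linarith
  have e1 := hm.cn (x := p') (y := r') (p := q) (by linarith) (by rw [dist_comm]; linarith)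
  have e2 := hm.cn (x := p') (y := r') (p := m) (by linarith) hmp'
  have e3 := hm.cn (x := p) (y := r) (p := r') (by linarith) hr'p
  rw [← hmm] at e3
  have e4 := hm.quadrilateral (a := p) (b := p') (c := r') (d := m) (by rwa [dist_comm])
    (by rw [dist_comm]; linarith) (by rw [dist_comm]; linarith)
  have e5 : h ≤ dist q m' + dist m m' := by
    rw [← a6]; exact dist_triangle_right _ _ _
  rw [← hm', ← he, dist_comm q p', p2, r1] at e1
  rw [← hm', ← he] at e2
  rw [dist_comm r' p, a3, r2, dist_comm r' m] at e3
  rw [p1, ← he, dist_comm p' m, dist_comm r' m, dist_comm m p, a4] at e4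
  set v := dist q m' with hv
  set u := dist m m' with hu
  have e6 : h ^ 2 ≤ (v + u) ^ 2 := pow_le_pow_left₀ hh0 e5 2
  have hv0 : 0 ≤ v := dist_nonneg
  obtain ⟨heb, hvh⟩ := eq_of_flat_inequalities hh0 hb0 he0 hv0 hflat e1 e2 e3 e4 e6
  exact ⟨p', r', m', p2, r1, by rw [← he, heb]; ring, by rw [m1, heb], by rw [m2, heb],
    by rw [← hv, hvh]⟩

/-- The apex stays fixed, so the flat triangles shrink into any ball around it. -/
lemma IsTriangleWithMedian.exists_div_two_pow (hm : IsMidpointMap ε mid) {q p r m : X}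
    {c₁ c₂ b h : ℝ} (ht : IsTriangleWithMedian q p r m c₁ c₂ b h)
    (hflat : c₁ ^ 2 + c₂ ^ 2 = 2 * h ^ 2 + 2 * b ^ 2)
    (hc₁ : c₁ < ε / 4) (hc₂ : c₂ < ε / 4) (hb : b < ε / 4) (n : ℕ) :
    ∃ p' r' m', IsTriangleWithMedian q p' r' m' (c₁ / 2 ^ n) (c₂ / 2 ^ n) (b / 2 ^ n)
      (h / 2 ^ n) := by
  induction n with
  | zero => exact ⟨p, r, m, by simpa using ht⟩
  | succ n ih =>
    obtain ⟨p', r', m', h'⟩ := ih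
    have key : ∀ x : ℝ, 0 ≤ x → x < ε / 4 → x / 2 ^ n < ε / 4 := fun x hx hx' =>
      lt_of_le_of_lt (div_le_self hx (one_le_pow₀ (by norm_num))) hx'
    have := h'.exists_half hm (by simp only [div_pow]; rw [← add_div, hflat]; ring)
      (key _ (ht.left ▸ dist_nonneg) hc₁) (key _ (ht.right ▸ dist_nonneg) hc₂)
      (key _ (ht.base_left ▸ dist_nonneg) hb)
    simpa only [pow_succ, div_div] using this

/-- Around a point of negative curvature no triangle is flat. -/
lemma IsCATNeg.not_flat (hm : IsMidpointMap ε mid) {k : ℝ} (hk : 0 < k) {S : Set X}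
    (hS : IsCATNeg k S) {q : X} {ρ : ℝ} (hρ : 0 < ρ) (hqS : Metric.ball q ρ ⊆ S) {p r m : X}
    {c₁ c₂ b h : ℝ} (ht : IsTriangleWithMedian q p r m c₁ c₂ b h)
    (hc₁ : c₁ < ε / 4) (hc₂ : c₂ < ε / 4) (hb : b < ε / 4) (hb0 : 0 < b)
    (h1 : 2 * b < c₁ + c₂) (h2 : |c₁ - c₂| < 2 * b) :
    c₁ ^ 2 + c₂ ^ 2 ≠ 2 * h ^ 2 + 2 * b ^ 2 := by
  intro hflat
  have hc₁0 : 0 ≤ c₁ := ht.left ▸ dist_nonneg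
  have hc₂0 : 0 ≤ c₂ := ht.right ▸ dist_nonneg
  have hh0 : 0 ≤ h := ht.median ▸ dist_nonneg
  obtain ⟨n, hn⟩ : ∃ n : ℕ, (c₁ + c₂) / 2 ^ n < ρ := by
    obtain ⟨n, hn⟩ := pow_unbounded_of_one_lt ((c₁ + c₂) / ρ) (one_lt_two (α := ℝ))
    refine ⟨n, ?_⟩
    rw [div_lt_iff₀ hρ] at hn
    rw [div_lt_iff₀ (by positivity)]
    linarith
  obtain ⟨p', r', m', h'⟩ := ht.exists_div_two_pow hm hflat hc₁ hc₂ hb n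
  have hpow : (1 : ℝ) ≤ 2 ^ n := one_le_pow₀ (by norm_num)
  have hle : b / 2 ^ n ≤ b := div_le_self hb0.le hpow
  have hk' : 0 < √k := Real.sqrt_pos.2 hk
  have hs : 0 < √k / 2 ^ n := by positivity
  -- The factor from the original lengths to the lengths of the comparison triangle: `√k` for the
  -- curvature, `2 ^ n` for the halvings.
  set s := √k / 2 ^ n with hs'
  have hsd : ∀ x : ℝ, √k * (x / 2 ^ n) = s * x := fun x => by rw [hs']; ring
  obtain ⟨q', a, c, d, t1, t2, t3, t4, t5, t6⟩ := UpperHalfPlane.exists_triangle_dist_lt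
    (b := s * b) (c₁ := s * c₁) (c₂ := s * c₂) (h := s * h) (by positivity) (by positivity)
    (by positivity) (by positivity) (by linear_combination s ^ 2 * hflat)
    (by nlinarith) (by
      rw [← mul_sub, abs_mul, abs_of_pos hs]
      nlinarith)
  have hp'S : p' ∈ S := hqS (by
    rw [Metric.mem_ball, h'.left]
    refine lt_of_le_of_lt ?_ hn
    gcongr; linarith)
  have hr'S : r' ∈ S := hqS (by
    rw [Metric.mem_ball, dist_comm, h'.right]
    refine lt_of_le_of_lt ?_ hn
    gcongr; linarith)
  have hqS' : q ∈ S := hqS (Metric.mem_ball_self hρ)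
  obtain ⟨A, hA, hAS⟩ := hS.1 p' hp'S q hqS'
  obtain ⟨B, hB, hBS⟩ := hS.1 p' hp'S r' hr'S
  obtain ⟨C, hC, hCS⟩ := hS.1 q hqS' r' hr'S
  have hm'B : m' ∈ B := by
    obtain ⟨w, hw, w1, w2⟩ := hB.exists_point (t := 1 / 2) (by norm_num)
    have hlt : dist p' r' < ε := by rw [h'.base]; linarith
    have e1 := hm.eq_mid (m := w) hlt (by linarith) (by linarith)
    have e2 := hm.eq_mid (m := m') hlt (by rw [h'.base_left, h'.base]; linarith)
      (by rw [h'.base_right, h'.base]; linarith)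
    rwa [e2, ← e1]
  have := hS.2 p' q r' A B C hA hB hC hAS hBS hCS q hA.right_mem m' hm'B a q' c q' d
    (by rw [t1, h'.left, hsd]) (by rw [t3, h'.base, ← hsd]; ring) (by rw [t2, h'.right, hsd])
    (by rw [t1, h'.left, hsd]) (by simp)
    (by rw [t4, h'.base_left, hsd]) (by rw [t5, h'.base_right, hsd])
  rw [h'.median, hsd] at this
  linarith

end FlatTriangles

/-! ### Homotopy classes of broken paths -/

namespace IsSimplyConnectedAtScale

variable {Y : Type*} [MetricSpace Y] {ε : ℝ}

/-- The homotopy class of the short paths between two close points. -/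
noncomputable def edge (hY : IsSimplyConnectedAtScale Y ε) {x y : Y} (h : dist x y < ε) :
    Path.Homotopic.Quotient x y :=
  Path.Homotopic.Quotient.mk (hY.exists_path x y h).choose

lemma edge_eq (hY : IsSimplyConnectedAtScale Y ε) {x y : Y} (h : dist x y < ε) (z : Y)
    (hz : dist z x + dist x y < 3 * ε) (γ : Path x y) (hγ : ∀ t, dist z (γ t) < 3 * ε) :
    hY.edge h = Path.Homotopic.Quotient.mk γ := by
  refine Path.Homotopic.Quotient.eq.2 (hY.homotopic z _ _ _ _ (fun t => ?_) hγ)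
  have h1 := (hY.exists_path x y h).choose_spec t
  have h2 := dist_triangle z x ((hY.exists_path x y h).choose t)
  linarith

lemma edge_self (hY : IsSimplyConnectedAtScale Y ε) {x : Y} (h : dist x x < ε) :
    hY.edge h = Path.Homotopic.Quotient.refl x := by
  rw [dist_self] at h
  exact hY.edge_eq _ x (by simpa using h) (Path.refl x) (fun t => by simpa using h)

lemma edge_trans_edge (hY : IsSimplyConnectedAtScale Y ε) {x y z : Y} (hxy : dist x y < ε)
    (hyz : dist y z < ε) (hxz : dist x z < ε) :
    (hY.edge hxy).trans (hY.edge hyz) = hY.edge hxz := by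
  have hε : 0 < ε := dist_nonneg.trans_lt hxy
  symm
  unfold edge
  rw [ ← Path.Homotopic.Quotient.mk_trans]
  change hY.edge hxz = _
  refine hY.edge_eq _ x (by rw [dist_self]; linarith) _ fun t => ?_
  have ht : ((hY.exists_path x y hxy).choose.trans (hY.exists_path y z hyz).choose) t ∈
      Set.range ((hY.exists_path x y hxy).choose.trans (hY.exists_path y z hyz).choose) := ⟨t, rfl⟩
  rw [Path.trans_range] at ht
  rcases ht with ⟨s, hs⟩ | ⟨s, hs⟩ <;> rw [← hs]
  · linarith [(hY.exists_path x y hxy).choose_spec s]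
  · linarith [(hY.exists_path y z hyz).choose_spec s,
      dist_triangle x y ((hY.exists_path y z hyz).choose s)]

/-- The homotopy class of the broken geodesic with vertices `c 0, …, c n`. -/
noncomputable def chain (hY : IsSimplyConnectedAtScale Y ε) (c : ℕ → Y)
    (hc : ∀ i, dist (c i) (c (i + 1)) < ε) : ∀ n, Path.Homotopic.Quotient (c 0) (c n)
  | 0 => Path.Homotopic.Quotient.refl _
  | n + 1 => (hY.chain c hc n).trans (hY.edge (hc n))

/-- A ladder between the two chains: the diagonals `h'` cut each rung square into two small
triangles, which commute by `edge_trans_edge`. -/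
lemma chain_trans_edge (hY : IsSimplyConnectedAtScale Y ε) {c c' : ℕ → Y}
    (hc : ∀ i, dist (c i) (c (i + 1)) < ε) (hc' : ∀ i, dist (c' i) (c' (i + 1)) < ε)
    (h : ∀ i, dist (c i) (c' i) < ε) (h' : ∀ i, dist (c i) (c' (i + 1)) < ε) (n : ℕ) :
    (hY.chain c hc n).trans (hY.edge (h n)) = (hY.edge (h 0)).trans (hY.chain c' hc' n) := by
  induction n with
  | zero => simp [chain]
  | succ n ih =>
    rw [chain, chain, Path.Homotopic.Quotient.trans_assoc,
      hY.edge_trans_edge (hc n) (h (n + 1)) (h' n),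
      ← Path.Homotopic.Quotient.trans_assoc, ← ih, Path.Homotopic.Quotient.trans_assoc,
      hY.edge_trans_edge (h n) (hc' n) (h' n)]

/-- The chain is coned off from its first vertex. -/
lemma chain_eq_edge (hY : IsSimplyConnectedAtScale Y ε) {c : ℕ → Y}
    (hc : ∀ i, dist (c i) (c (i + 1)) < ε) {n : ℕ} (h : ∀ i ≤ n, dist (c 0) (c i) < ε) :
    hY.chain c hc n = hY.edge (h n le_rfl) := by
  induction n with
  | zero => rw [chain, edge_self]
  | succ n ih =>
    rw [chain, ih fun i hi => h i (by omega), hY.edge_trans_edge]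

lemma chain_eq_subpath (hY : IsSimplyConnectedAtScale Y ε) {a b : Y} (γ : Path a b)
    {t : ℕ → unitInterval} (ht : Monotone t) (hc : ∀ i, dist (γ (t i)) (γ (t (i + 1))) < ε)
    (h : ∀ i, ∀ s ∈ Set.Icc (t i) (t (i + 1)), dist (γ (t i)) (γ s) < ε) (n : ℕ) :
    hY.chain (fun i => γ (t i)) hc n = Path.Homotopic.Quotient.mk (γ.subpath (t 0) (t n)) := by
  induction n with
  | zero => rw [chain, Path.subpath_self]; rfl
  | succ n ih =>
    have hε : 0 < ε := dist_nonneg.trans_lt (hc 0)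
    rw [chain, ih, hY.edge_eq (hc n) (γ (t n)) (by rw [dist_self]; linarith [hc n])
      (γ.subpath (t n) (t (n + 1))), ← Path.Homotopic.Quotient.mk_trans]
    · exact Path.Homotopic.Quotient.eq.2 ⟨Path.Homotopy.subpathTransSubpath γ _ _ _⟩
    · intro s
      have hs : γ.subpath (t n) (t (n + 1)) s ∈ Set.range (γ.subpath (t n) (t (n + 1))) := ⟨s, rfl⟩
      rw [Path.range_subpath_of_le _ _ _ (ht n.le_succ)] at hs
      obtain ⟨u, hu, e⟩ := hs
      rw [← e]
      linarith [h n u hu]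

/-- A closed chain is null-homotopic if a close closed chain is. -/
lemma chain_eq_edge_of_close (hY : IsSimplyConnectedAtScale Y ε) {c c' : ℕ → Y}
    (hc : ∀ i, dist (c i) (c (i + 1)) < ε) (hc' : ∀ i, dist (c' i) (c' (i + 1)) < ε)
    (h : ∀ i, dist (c i) (c' i) < ε) (h' : ∀ i, dist (c i) (c' (i + 1)) < ε) {n : ℕ}
    (hn : c n = c 0) (h0 : dist (c 0) (c n) < ε)
    (h0' : dist (c' 0) (c' n) < ε) (htriv : hY.chain c hc n = hY.edge h0) :
    hY.chain c' hc' n = hY.edge h0' := by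
  have key := hY.chain_trans_edge hc hc' h h' n
  have h3 : dist (c 0) (c' n) < ε := by rw [← hn]; exact h n
  rw [htriv, hY.edge_trans_edge h0 (h n) h3, ← hY.edge_trans_edge (h 0) h0' h3] at key
  have := congrArg (fun q => (Path.Homotopic.Quotient.symm (hY.edge (h 0))).trans q) key
  simpa only [← Path.Homotopic.Quotient.trans_assoc, Path.Homotopic.Quotient.symm_trans,
    Path.Homotopic.Quotient.refl_trans] using this.symm

end IsSimplyConnectedAtScale

/-! ### Classes of paths homotopic into the subspace -/

section Into

variable {X : Type*} [MetricSpace X]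

/-- A homotopy class of paths is homotopic into `Z` if it is the class of a path in `Z`. -/
def IsHomotopicInto (Z : Set X) {x y : X} (q : Path.Homotopic.Quotient x y) : Prop :=
  ∃ (a b : Z) (p : Path.Homotopic.Quotient a b) (hx : x = a) (hy : y = b),
    q = (p.map ⟨Subtype.val, continuous_subtype_val⟩).cast hx hy

variable {Z : Set X}

lemma IsHomotopicInto.refl {x : X} (hx : x ∈ Z) : 
    IsHomotopicInto Z (Path.Homotopic.Quotient.refl x) :=
  ⟨⟨x, hx⟩, ⟨x, hx⟩, Path.Homotopic.Quotient.refl _, rfl, rfl, by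
    rw [Path.Homotopic.Quotient.cast_rfl_rfl]; rfl⟩

lemma IsHomotopicInto.trans {x y z : X} {q : Path.Homotopic.Quotient x y}
    {q' : Path.Homotopic.Quotient y z} (h : IsHomotopicInto Z q) (h' : IsHomotopicInto Z q') :
    IsHomotopicInto Z (q.trans q') := by
  obtain ⟨a, b, p, rfl, rfl, rfl⟩ := h
  obtain ⟨b', c, p', hb, rfl, rfl⟩ := h'
  obtain rfl := Subtype.ext hb
  refine ⟨a, c, p.trans p', rfl, rfl, ?_⟩
  simp only [Path.Homotopic.Quotient.cast_rfl_rfl]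
  induction p using Path.Homotopic.Quotient.ind with | mk p =>
  induction p' using Path.Homotopic.Quotient.ind with | mk p' =>
  exact congrArg Path.Homotopic.Quotient.mk (Path.map_trans p p' continuous_subtype_val).symm

lemma IsHomotopicInto.symm {x y : X} {q : Path.Homotopic.Quotient x y}
    (h : IsHomotopicInto Z q) : IsHomotopicInto Z q.symm := by
  obtain ⟨a, b, p, rfl, rfl, rfl⟩ := h
  refine ⟨b, a, p.symm, rfl, rfl, ?_⟩
  simp only [Path.Homotopic.Quotient.cast_rfl_rfl]
  induction p using Path.Homotopic.Quotient.ind with | mk p =>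
  rfl

lemma IsSimplyConnectedAtScale.edge_isHomotopicInto {ε ε' : ℝ}
    (hX : IsSimplyConnectedAtScale X ε) (hZ : IsSimplyConnectedAtScale Z ε') {x y : X}
    (hx : x ∈ Z) (hy : y ∈ Z) (h : dist x y < ε) (h' : dist x y < ε') :
    IsHomotopicInto Z (hX.edge h) := by
  obtain ⟨γ, hγ⟩ := hZ.exists_path ⟨x, hx⟩ ⟨y, hy⟩ h'
  refine ⟨⟨x, hx⟩, ⟨y, hy⟩, Path.Homotopic.Quotient.mk γ, rfl, rfl, ?_⟩
  rw [Path.Homotopic.Quotient.cast_rfl_rfl, ← Path.Homotopic.Quotient.mk_map]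
  have hε : 0 < ε := dist_nonneg.trans_lt h
  refine hX.edge_eq h x (by rw [dist_self]; linarith) _ fun t => ?_
  have := hγ t
  rw [Subtype.dist_eq, Subtype.dist_eq] at this
  change dist x (γ t : X) < _
  simp only at this
  linarith

lemma IsSimplyConnectedAtScale.chain_isHomotopicInto {ε ε' : ℝ}
    (hX : IsSimplyConnectedAtScale X ε) (hZ : IsSimplyConnectedAtScale Z ε') {c : ℕ → X}
    (hc : ∀ i, dist (c i) (c (i + 1)) < ε) {n : ℕ} (hcZ : ∀ i ≤ n, c i ∈ Z)
    (hc' : ∀ i, dist (c i) (c (i + 1)) < ε') :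
    IsHomotopicInto Z (hX.chain c hc n) := by
  induction n with
  | zero => exact .refl (hcZ 0 le_rfl)
  | succ n ih =>
    exact (ih fun i hi => hcZ i (by omega)).trans
      (hX.edge_isHomotopicInto hZ (hcZ n (by omega)) (hcZ (n + 1) le_rfl) _ (hc' n))

/-- The two classes differ only by the short edges joining their ends, and these edges can be taken
in `Z`. -/
lemma IsSimplyConnectedAtScale.chain_isHomotopicInto_of_close {ε ε' : ℝ}
    (hX : IsSimplyConnectedAtScale X ε) (hZ : IsSimplyConnectedAtScale Z ε') {c c' : ℕ → X}
    (hc : ∀ i, dist (c i) (c (i + 1)) < ε) (hc' : ∀ i, dist (c' i) (c' (i + 1)) < ε)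
    (h : ∀ i, dist (c i) (c' i) < ε) (h' : ∀ i, dist (c i) (c' (i + 1)) < ε) {n : ℕ}
    (h0 : c 0 ∈ Z) (hn : c n ∈ Z) (h0' : c' 0 ∈ Z) (hn' : c' n ∈ Z)
    (d0 : dist (c 0) (c' 0) < ε') (dn : dist (c n) (c' n) < ε')
    (hinto : IsHomotopicInto Z (hX.chain c hc n)) : IsHomotopicInto Z (hX.chain c' hc' n) := by
  have key := hX.chain_trans_edge hc hc' h h' n
  have e : hX.chain c' hc' n = (Path.Homotopic.Quotient.symm (hX.edge (h 0))).trans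
      ((hX.chain c hc n).trans (hX.edge (h n))) := by
    rw [key, ← Path.Homotopic.Quotient.trans_assoc, Path.Homotopic.Quotient.symm_trans,
      Path.Homotopic.Quotient.refl_trans]
  rw [e]
  exact (hX.edge_isHomotopicInto hZ h0 h0' _ d0).symm.trans
    (hinto.trans (hX.edge_isHomotopicInto hZ hn hn' _ dn))

end Into

/-! ### Birkhoff shortening and parallel closed geodesics -/

section ClosedChains

variable {X : Type*} [MetricSpace X] {ε δ D : ℝ} {mid : X → X → X} {N : ℕ}

/-- One step of Birkhoff's curve shortening: the closed polygon of the midpoints of the edges. -/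
def shorten (mid : X → X → X) (c : ZMod N → X) : ZMod N → X := fun i => mid (c i) (c (i + 1))

/-- The closed polygon `c` is a local geodesic with edges of length `a`. -/
def IsClosedGeodesic (c : ZMod N → X) (a : ℝ) : Prop :=
  ∀ i, dist (c i) (c (i + 1)) = a ∧ dist (c i) (c (i + 1 + 1)) = 2 * a

/-- The energy of a closed polygon. -/
noncomputable def chainEnergy [NeZero N] (c : ZMod N → X) : ℝ := ∑ i, dist (c i) (c (i + 1)) ^ 2

lemma sum_add_one [NeZero N] (f : ZMod N → ℝ) : ∑ i, f (i + 1) = ∑ i, f i :=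
  Equiv.sum_comp (Equiv.addRight (1 : ZMod N)) f

lemma ZMod.forall_eq_zero_of_add_one [NeZero N] {f : ZMod N → ℝ} (h : ∀ i, f (i + 1) = f i)
    (i : ZMod N) : f i = f 0 := by
  have : ∀ n : ℕ, f n = f 0 := by
    intro n
    induction n with
    | zero => simp
    | succ n ih => rw [Nat.cast_succ, h, ih]
  simpa using this i.val

namespace IsMidpointMap

lemma dist_shorten_succ_le (hm : IsMidpointMap ε mid) (hδ : δ < ε) {c : ZMod N → X}
    (hc : ∀ i, dist (c i) (c (i + 1)) ≤ δ) (i : ZMod N) :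
    dist (shorten mid c i) (shorten mid c (i + 1)) ≤ δ := by
  have h1 := hm.dist_right ((hc i).trans_lt hδ)
  have h2 := hm.dist_left ((hc (i + 1)).trans_lt hδ)
  have := dist_triangle (shorten mid c i) (c (i + 1)) (shorten mid c (i + 1))
  simp only [shorten] at *
  linarith [hc i, hc (i + 1)]

lemma dist_self_shorten_le (hm : IsMidpointMap ε mid) (hδ : δ < ε) {c : ZMod N → X}
    (hc : ∀ i, dist (c i) (c (i + 1)) ≤ δ) (i : ZMod N) : dist (c i) (shorten mid c i) ≤ δ := by
  have h1 := hm.dist_left ((hc i).trans_lt hδ)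
  simp only [shorten] at *
  linarith [hc i, dist_nonneg (x := c i) (y := c (i + 1))]

/-- Keeps neighbouring stages of a homotopy close through all iterations. -/
lemma dist_shorten_shorten_le (hm : IsMidpointMap ε mid) (hδ : δ < ε / 3) (hD : D < ε / 3)
    {c c' : ZMod N → X} (hc : ∀ i, dist (c i) (c (i + 1)) ≤ δ)
    (hc' : ∀ i, dist (c' i) (c' (i + 1)) ≤ δ) (h : ∀ i, dist (c i) (c' i) ≤ D) (i : ZMod N) :
    dist (shorten mid c i) (shorten mid c' i) ≤ D := by
  have h1 := hm.dist_mid_mid_sq_le ((hc i).trans_lt hδ) ((hc' i).trans_lt hδ)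
    ((h i).trans_lt hD)
  have hD0 : 0 ≤ D := dist_nonneg.trans (h i)
  have h2 := pow_le_pow_left₀ dist_nonneg (h i) 2
  have h3 := pow_le_pow_left₀ dist_nonneg (h (i + 1)) 2
  exact (abs_le_of_sq_le_sq' (by simp only [shorten]; linarith) hD0).2

/-- A new edge is at most half of `dist (c i) (c (i + 2))`, hence at most the mean of two old edges,
and the square of a mean is at most the mean of the squares. Equality of the sums forces equality
termwise: equal consecutive edges and no angle at the vertices. -/
lemma chainEnergy_shorten_le [NeZero N] (hm : IsMidpointMap ε mid) (hδ : δ < ε / 3)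
    {c : ZMod N → X} (hc : ∀ i, dist (c i) (c (i + 1)) ≤ δ) :
    chainEnergy (shorten mid c) ≤ chainEnergy c ∧
      (chainEnergy (shorten mid c) = chainEnergy c → ∃ a, IsClosedGeodesic c a) := by
  set f : ZMod N → ℝ := fun i => dist (c i) (c (i + 1)) with hf
  have h1 : ∀ i, 4 * dist (shorten mid c i) (shorten mid c (i + 1)) ^ 2 ≤
      dist (c i) (c (i + 1 + 1)) ^ 2 := by
    intro i
    have := hm.dist_mid_mid_le_half ((hc i).trans_lt hδ) ((hc (i + 1)).trans_lt hδ)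
    have := pow_le_pow_left₀ (by positivity) this 2
    simp only [shorten]
    linarith
  have h2 : ∀ i, dist (c i) (c (i + 1 + 1)) ^ 2 ≤ (f i + f (i + 1)) ^ 2 := fun i =>
    pow_le_pow_left₀ dist_nonneg (dist_triangle _ _ _) 2
  have h3 : ∀ i, (f i + f (i + 1)) ^ 2 ≤ 2 * f i ^ 2 + 2 * f (i + 1) ^ 2 := fun i => by
    linarith [sq_nonneg (f i - f (i + 1))]
  have hsum : ∑ i, (2 * f i ^ 2 + 2 * f (i + 1) ^ 2) = 4 * chainEnergy c := by
    rw [Finset.sum_add_distrib, sum_add_one (fun i => 2 * f i ^ 2), ← two_mul, ← Finset.mul_sum,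
      ← mul_assoc, chainEnergy]
    norm_num [hf]
  have hsum' : ∑ i, 4 * dist (shorten mid c i) (shorten mid c (i + 1)) ^ 2 =
      4 * chainEnergy (shorten mid c) := by rw [← Finset.mul_sum, chainEnergy]
  have h4 : ∀ i ∈ Finset.univ, 4 * dist (shorten mid c i) (shorten mid c (i + 1)) ^ 2 ≤
    2 * f i ^ 2 + 2 * f (i + 1) ^ 2 := fun i _ => (h1 i).trans ((h2 i).trans (h3 i))
  refine ⟨by linarith [Finset.sum_le_sum h4], fun heq => ?_⟩
  have h5 := (Finset.sum_eq_sum_iff_of_le h4).1 (by rw [hsum, hsum', heq])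
  have h6 : ∀ i, f (i + 1) = f i := by
    intro i
    have e := h5 i (Finset.mem_univ i)
    have : (f i - f (i + 1)) ^ 2 = 0 := by
      refine le_antisymm ?_ (sq_nonneg _)
      linarith [h1 i, h2 i]
    linarith [pow_eq_zero_iff two_ne_zero |>.1 this]
  refine ⟨f 0, fun i => ⟨ZMod.forall_eq_zero_of_add_one h6 i, ?_⟩⟩
  have e := h5 i (Finset.mem_univ i)
  rw [← ZMod.forall_eq_zero_of_add_one h6 i]
  have e1 := h1 i
  have e2 := h2 i
  rw [h6 i] at e e2
  have h7 : dist (c i) (c (i + 1 + 1)) ^ 2 = (2 * f i) ^ 2 := by linarith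
  exact (sq_eq_sq₀ dist_nonneg (mul_nonneg zero_le_two dist_nonneg)).1 h7

lemma tendsto_mid (hm : IsMidpointMap ε mid) {u v : ℕ → X} {x y : X}
    (hu : Tendsto u atTop (𝓝 x)) (hv : Tendsto v atTop (𝓝 y)) (hxy : dist x y < ε / 3) :
    Tendsto (fun n => mid (u n) (v n)) atTop (𝓝 (mid x y)) := by
  have hε : 0 < ε / 3 := dist_nonneg.trans_lt hxy
  rw [tendsto_iff_dist_tendsto_zero] at *
  refine squeeze_zero' (Eventually.of_forall fun _ => dist_nonneg) ?_
    (by simpa using hu.add hv)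
  have huv : ∀ᶠ n in atTop, dist (u n) (v n) < ε / 3 := by
    rw [← tendsto_iff_dist_tendsto_zero] at hu hv
    exact (hu.dist hv).eventually_lt_const hxy
  filter_upwards [hu.eventually_lt_const hε, huv] with n h1 h3
  have := hm.dist_mid_mid_sq_le h3 hxy h1
  have h4 : dist (mid (u n) (v n)) (mid x y) ^ 2 ≤ (dist (u n) x + dist (v n) y) ^ 2 := by
    nlinarith [dist_nonneg (x := u n) (y := x), dist_nonneg (x := v n) (y := y),
      sq_nonneg (dist (mid (u n) (v n)) (mid x y))]
  exact (abs_le_of_sq_le_sq' h4 (add_nonneg dist_nonneg dist_nonneg)).2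

lemma dist_iterate_shorten_succ_le (hm : IsMidpointMap ε mid) (hδ : δ < ε) {c : ZMod N → X}
    (hc : ∀ i, dist (c i) (c (i + 1)) ≤ δ) (n : ℕ) (i : ZMod N) :
    dist ((shorten mid)^[n] c i) ((shorten mid)^[n] c (i + 1)) ≤ δ := by
  induction n generalizing i with
  | zero => exact hc i
  | succ n ih =>
    rw [Function.iterate_succ_apply']
    exact hm.dist_shorten_succ_le hδ ih i

lemma tendsto_chainEnergy [NeZero N] {u : ℕ → ZMod N → X} {c : ZMod N → X}
    (h : ∀ i, Tendsto (fun n => u n i) atTop (𝓝 (c i))) :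
    Tendsto (fun n => chainEnergy (u n)) atTop (𝓝 (chainEnergy c)) :=
  tendsto_finsetSum _ fun i _ => ((h i).dist (h (i + 1))).pow 2

/-- Accumulation points of the curve shortening process are local geodesics. -/
lemma isClosedGeodesic_of_tendsto [NeZero N] (hm : IsMidpointMap ε mid) (hδ : δ < ε / 3)
    (hε : 0 < ε) {c c' : ZMod N → X} (hc : ∀ i, dist (c i) (c (i + 1)) ≤ δ) {φ : ℕ → ℕ}
    (hφ : StrictMono φ)
    (h : ∀ i, Tendsto (fun n => (shorten mid)^[φ n] c i) atTop (𝓝 (c' i))) :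
    ∃ a, IsClosedGeodesic c' a := by
  have hδ' : δ < ε := by linarith
  have hstep := hm.dist_iterate_shorten_succ_le hδ' hc
  have hc' : ∀ i, dist (c' i) (c' (i + 1)) ≤ δ := fun i =>
    le_of_tendsto ((h i).dist (h (i + 1))) (Eventually.of_forall fun n => hstep (φ n) i)
  -- The energies of the iterates decrease to a limit; by continuity both `c'` and `shorten mid c'`
  -- have this energy.
  refine (hm.chainEnergy_shorten_le hδ hc').2 ?_
  have hanti : Antitone fun n => chainEnergy ((shorten mid)^[n] c) := by
    refine antitone_nat_of_succ_le fun n => ?_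
    rw [Function.iterate_succ_apply']
    exact (hm.chainEnergy_shorten_le hδ (hstep n)).1
  have hlim := tendsto_atTop_ciInf hanti ⟨0, by
    rintro _ ⟨n, rfl⟩
    exact Finset.sum_nonneg fun i _ => sq_nonneg _⟩
  have h1 := tendsto_nhds_unique (hlim.comp hφ.tendsto_atTop) (tendsto_chainEnergy h)
  have h2 : Tendsto (fun n => chainEnergy ((shorten mid)^[φ n + 1] c)) atTop
      (𝓝 (chainEnergy (shorten mid c'))) := by
    simp only [Function.iterate_succ_apply']
    exact tendsto_chainEnergy fun i => hm.tendsto_mid (h i) (h (i + 1)) ((hc' i).trans_lt hδ)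
  have h3 := tendsto_nhds_unique
    (hlim.comp ((tendsto_add_atTop_nat 1).comp hφ.tendsto_atTop)) h2
  rw [← h1, ← h3]

/-- Two parallel closed geodesics have the same speed and bound flat triangles. -/
lemma flat_of_isClosedGeodesic [NeZero N] (hm : IsMidpointMap ε mid) {c c' : ZMod N → X}
    {a a' : ℝ} (ha : a < ε / 3) (ha' : a' < ε / 3) (hD : D < ε / 3) (hc : IsClosedGeodesic c a)
    (hc' : IsClosedGeodesic c' a') (h : ∀ i, dist (c i) (c' i) ≤ D) :
    a = a' ∧ ∀ i, dist (c i) (c' (i + 1)) ^ 2 + dist (c' (i + 1)) (c (i + 1 + 1)) ^ 2 =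
      2 * dist (c' (i + 1)) (c (i + 1)) ^ 2 + 2 * a ^ 2 := by
  have hε : 0 < ε / 3 := (dist_nonneg.trans (h 0)).trans_lt hD
  have ha0 : 0 ≤ a := (hc 0).1 ▸ dist_nonneg
  have ha0' : 0 ≤ a' := (hc' 0).1 ▸ dist_nonneg
  have hmid : ∀ {c : ZMod N → X} {a : ℝ}, a < ε / 3 → IsClosedGeodesic c a → ∀ i,
      c (i + 1) = mid (c i) (c (i + 1 + 1)) := fun {c a} ha hc i =>
    hm.eq_mid (by rw [(hc i).2]; linarith) (by rw [(hc i).1, (hc i).2]; linarith)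
      (by rw [(hc (i + 1)).1, (hc i).2]; linarith)
  set f : ZMod N → ℝ := fun i => dist (c i) (c' i) ^ 2 with hf
  set p : ZMod N → ℝ := fun i => dist (c i) (c' (i + 1)) ^ 2 with hp
  set q : ZMod N → ℝ := fun i => dist (c (i + 1)) (c' i) ^ 2 with hq
  have cn1 : ∀ i, 2 * a ^ 2 + 2 * f (i + 1) ≤ p i + q (i + 1) := by
    intro i
    have h1 := hm.cn (x := c i) (y := c (i + 1 + 1)) (p := c' (i + 1))
      (by rw [(hc i).2]; linarith) (by
        rw [dist_comm]
        linarith [dist_triangle (c i) (c (i + 1)) (c' (i + 1)), (hc i).1, h (i + 1)])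
    rw [← hmid ha hc, (hc i).2, dist_comm (c' (i + 1)), dist_comm (c' (i + 1)),
      dist_comm (c' (i + 1))] at h1
    simp only [hp, hq, hf]
    linarith
  have cn2 : ∀ i, 2 * a' ^ 2 + 2 * f (i + 1) ≤ q i + p (i + 1) := by
    intro i
    have h1 := hm.cn (x := c' i) (y := c' (i + 1 + 1)) (p := c (i + 1))
      (by rw [(hc' i).2]; linarith) (by
        rw [dist_comm]
        linarith [dist_triangle_right (c' i) (c (i + 1)) (c' (i + 1)), (hc' i).1, h (i + 1)])
    rw [← hmid ha' hc', (hc' i).2] at h1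
    simp only [hp, hq, hf]
    linarith
  have quad : ∀ i, p i + q i ≤ a ^ 2 + a' ^ 2 + f i + f (i + 1) := by
    intro i
    have h1 := hm.quadrilateral (a := c i) (b := c (i + 1)) (c := c' (i + 1)) (d := c' i)
      (by linarith [dist_triangle (c i) (c (i + 1)) (c' (i + 1)), (hc i).1, h (i + 1)])
      (by rw [dist_comm]; linarith [(hc i).1]) (by rw [dist_comm]; linarith [h i])
    rw [(hc i).1, dist_comm (c' (i + 1)) (c' i), (hc' i).1, dist_comm (c' i) (c i)] at h1
    simp only [hp, hq, hf]
    linarith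
  -- Around the circle the index shifts disappear. The sum of all `p i + q i` is bounded below by
  -- `cn1` and `cn2` and above by `quad`; hence `a = a'`, and every `cn1` is an equality.
  have s1 := Finset.sum_le_sum fun i (_ : i ∈ Finset.univ) => cn1 i
  have s2 := Finset.sum_le_sum fun i (_ : i ∈ Finset.univ) => cn2 i
  have s3 := Finset.sum_le_sum fun i (_ : i ∈ Finset.univ) => quad i
  simp only [Finset.sum_add_distrib, ← Finset.mul_sum, sum_add_one f, sum_add_one p,
    sum_add_one q, Finset.sum_const, Finset.card_univ, ZMod.card, nsmul_eq_mul] at s1 s2 s3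
  have hN : (0 : ℝ) < N := by exact_mod_cast Nat.pos_of_ne_zero (NeZero.ne N)
  have hsq : a ^ 2 = a' ^ 2 := by
    apply le_antisymm <;> refine le_of_mul_le_mul_left ?_ hN <;> linarith
  refine ⟨(sq_eq_sq₀ ha0 ha0').1 hsq, ?_⟩
  rw [← hsq] at s3
  have s4 := (Finset.sum_eq_sum_iff_of_le fun i (_ : i ∈ Finset.univ) => cn1 i).1 (by
    simp only [Finset.sum_add_distrib, ← Finset.mul_sum, sum_add_one f, sum_add_one q,
      Finset.sum_const, Finset.card_univ, ZMod.card, nsmul_eq_mul]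
    linarith)
  intro i
  have := s4 i (Finset.mem_univ i)
  simp only [hp, hq, hf] at this
  rw [dist_comm (c' (i + 1)), dist_comm (c' (i + 1))]
  linarith

/-- Geodesics between close points are unique: they contain all points between their ends. -/
lemma mem_of_between (hm : IsMidpointMap ε mid) {p q r : X} {A : Set X}
    (hA : IsGeodesicSegment p r A) (h : dist p q + dist q r = dist p r) (hpq : dist p q < ε / 2)
    (hqr : dist q r < ε / 2) : q ∈ A := by
  rcases (dist_nonneg (x := p) (y := r)).eq_or_lt with h0 | h0
  · have : dist p q = 0 := by
      linarith [dist_nonneg (x := p) (y := q), dist_nonneg (x := q) (y := r)]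
    rw [← dist_eq_zero.1 this]
    exact hA.left_mem
  obtain ⟨q', hq', h1, h2⟩ := hA.exists_point (t := dist p q / dist p r)
    ⟨by positivity, by rw [div_le_one h0]; linarith [dist_nonneg (x := q) (y := r)]⟩
  have h1 : dist p q' = dist p q := by rw [h1]; field_simp
  have h2 : dist q' r = dist q r := by
    rw [h2]; field_simp; linarith
  have hqq : dist q q' < ε := by
    have := dist_triangle_left q q' p
    linarith
  -- If `q ≠ q'`, their midpoint would be closer to both ends, against the triangle inequality.
  have e1 := hm.cn (p := p) hqq (by linarith)
  have e2 := hm.cn (p := r) hqq (by rw [dist_comm]; linarith)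
  rw [h1] at e1
  rw [dist_comm r q, dist_comm r q', h2] at e2
  have e3 : dist p r ≤ dist p (mid q q') + dist r (mid q q') := dist_triangle_right _ _ _
  have e4 : dist r (mid q q') ≤ dist q r :=
    (abs_le_of_sq_le_sq' (by nlinarith [sq_nonneg (dist q q')]) dist_nonneg).2
  have e5 : dist p q ≤ dist p (mid q q') := by linarith
  have e6 := pow_le_pow_left₀ dist_nonneg e5 2
  have e7 : dist q q' ^ 2 = 0 := le_antisymm (by linarith) (sq_nonneg _)
  rwa [dist_eq_zero.1 (pow_eq_zero_iff two_ne_zero |>.1 e7)]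

/-- A closed geodesic parallel to one in `Z` does not enter the negatively curved region. -/
lemma mem_of_isClosedGeodesic [NeZero N] (hm : IsMidpointMap ε mid) {Z : Set X} {k : ℝ}
    (hk : 0 < k) {c c' : ZMod N → X} {a : ℝ} (ha : a < ε / 8) (hDa : D < a)
    (hc : IsClosedGeodesic c a) (hc' : IsClosedGeodesic c' a) (h : ∀ i, dist (c i) (c' i) ≤ D)
    (hgeod : ∀ i, ∃ A ⊆ Z, IsGeodesicSegment (c i) (c (i + 1 + 1)) A)
    (hneg : ∀ i, c' i ∉ Z → ∃ S, IsCATNeg k S ∧ ∃ ρ > 0, Metric.ball (c' i) ρ ⊆ S) (i : ZMod N) :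
    c' i ∈ Z := by
  obtain ⟨i, rfl⟩ : ∃ j, i = j + 1 := ⟨i - 1, by ring⟩
  by_contra hi
  obtain ⟨S, hS, ρ, hρ, hqS⟩ := hneg _ hi
  obtain ⟨A, hAZ, hA⟩ := hgeod i
  have hD0 : 0 ≤ D := dist_nonneg.trans (h 0)
  have hflat := (hm.flat_of_isClosedGeodesic (by linarith) (by linarith) (by linarith) hc hc' h).2 i
  have hh := h (i + 1)
  have h1 := dist_triangle (c i) (c (i + 1)) (c' (i + 1))
  have h2 := dist_triangle_right (c i) (c (i + 1)) (c' (i + 1))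
  have h3 := dist_triangle_left (c' (i + 1)) (c (i + 1 + 1)) (c (i + 1))
  have h4 := dist_triangle_left (c (i + 1)) (c (i + 1 + 1)) (c' (i + 1))
  have h5 := dist_triangle (c i) (c' (i + 1)) (c (i + 1 + 1))
  rw [(hc i).1] at h1 h2
  rw [(hc (i + 1)).1] at h3 h4
  rw [(hc i).2] at h5
  rw [dist_comm (c' (i + 1)) (c (i + 1))] at h4
  -- A degenerate triangle has its apex on the geodesic between the base vertices, inside `Z`.
  rcases h5.eq_or_lt with h5 | h5
  · exact hi (hAZ (hm.mem_of_between hA (by rw [← h5, (hc i).2]) (by linarith) (by linarith)))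
  · refine hS.not_flat hm hk hρ hqS (p := c i) (r := c (i + 1 + 1)) (m := c (i + 1)) (b := a)
      ⟨rfl, rfl, (hc i).2, (hc i).1, (hc (i + 1)).1, rfl⟩ (by linarith) (by linarith) (by linarith)
      (by linarith) h5 ?_ hflat
    -- The sides differ by at most `2 * D`, and `D < a`: the apex is not on the extended base.
    rw [abs_lt]
    constructor <;> linarith

end IsMidpointMap

end ClosedChains

/-! ### Null-homotopic closed polygons -/

section NullChains

variable {Y : Type*} [MetricSpace Y] {ε η : ℝ} {N : ℕ}

/-- The closed polygon `c` is null-homotopic. -/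
def IsNullChain (hY : IsSimplyConnectedAtScale Y ε) (c : ZMod N → Y) : Prop :=
  ∃ (hc : ∀ i : ℕ, dist (c i) (c (i + 1 : ℕ)) < ε) (h0 : dist (c (0 : ℕ)) (c N) < ε),
    hY.chain (fun i : ℕ => c i) hc N = hY.edge h0

lemma IsNullChain.of_close {hY : IsSimplyConnectedAtScale Y ε} (hη : 2 * η < ε)
    {c c' : ZMod N → Y} (hc' : ∀ i, dist (c' i) (c' (i + 1)) ≤ η) (h : ∀ i, dist (c i) (c' i) ≤ η)
    (hnull : IsNullChain hY c) : IsNullChain hY c' := by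
  obtain ⟨h1, h0, he⟩ := hnull
  have hη0 : 0 ≤ η := dist_nonneg.trans (h 0)
  have hN : ∀ c : ZMod N → Y, c N = c (0 : ℕ) := fun c => by simp
  have h1' : ∀ i : ℕ, dist (c' i) (c' (i + 1 : ℕ)) < ε := fun i => by
    rw [Nat.cast_succ]; linarith [hc' i]
  have h0' : dist (c' (0 : ℕ)) (c' N) < ε := by rw [hN c', dist_self]; linarith
  refine ⟨h1', h0', hY.chain_eq_edge_of_close h1 h1' (fun i => by linarith [h i]) (fun i => ?_)
    (hN c) h0 h0' he⟩
  rw [Nat.cast_succ]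
  linarith [dist_triangle (c i) (c' i) (c' (i + 1)), h i, hc' i]

lemma IsNullChain.of_iterate {hY : IsSimplyConnectedAtScale Y ε} (hη : 2 * η < ε)
    {u : ℕ → ZMod N → Y} (hu : ∀ n i, dist (u n i) (u n (i + 1)) ≤ η)
    (hmove : ∀ n i, dist (u n i) (u (n + 1) i) ≤ η) {n : ℕ} (h : IsNullChain hY (u n)) :
    IsNullChain hY (u 0) := by
  induction n with
  | zero => exact h
  | succ n ih =>
    exact ih (h.of_close hη (hu _) fun i => by rw [dist_comm]; exact hmove n i)

/-- Short closed polygons are null-homotopic. -/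
lemma isNullChain_of_mul_lt [NeZero N] (hY : IsSimplyConnectedAtScale Y ε) {c : ZMod N → Y} {a : ℝ}
    (hc : ∀ i, dist (c i) (c (i + 1)) ≤ a) (ha : N * a < ε) : IsNullChain hY c := by
  have ha0 : 0 ≤ a := dist_nonneg.trans (hc 0)
  have hN : (1 : ℝ) ≤ N := by exact_mod_cast Nat.one_le_iff_ne_zero.2 (NeZero.ne N)
  have h1 : ∀ i : ℕ, dist (c (0 : ℕ)) (c i) ≤ i * a := by
    intro i
    induction i with
    | zero => simp
    | succ i ih =>
      push_cast at ih ⊢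
      linarith [dist_triangle (c 0) (c i) (c (i + 1)), hc i]
  have h2 : ∀ i ≤ N, dist (c (0 : ℕ)) (c i) < ε := fun i hi =>
    ((h1 i).trans (mul_le_mul_of_nonneg_right (by exact_mod_cast hi) ha0)).trans_lt ha
  have h3 : ∀ i : ℕ, dist (c i) (c (i + 1 : ℕ)) < ε := fun i => by
    rw [Nat.cast_succ]
    nlinarith [hc i]
  exact ⟨h3, h2 N le_rfl, hY.chain_eq_edge h3 h2⟩

end NullChains

/-! ### Shortening a whole free homotopy -/

section Scale

variable {X : Type*} [MetricSpace X]

/-- A scale at which the geometry and the topology of `X`, and of `X` around `Z`, are under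
control. -/
structure IsNegativelyCurvedScale (Z : Set X) (k ε : ℝ) (mid : X → X → X) : Prop where
  pos : 0 < ε
  curvature_pos : 0 < k
  isClosed : IsClosed Z
  isMidpointMap : IsMidpointMap ε mid
  simplyConnected : IsSimplyConnectedAtScale X ε
  simplyConnected_subspace : IsSimplyConnectedAtScale Z ε
  mid_mem : ∀ x ∈ Z, ∀ y ∈ Z, dist x y < ε → mid x y ∈ Z
  geodesic : ∀ x ∈ Z, ∀ y ∈ Z, dist x y < ε → ∃ A ⊆ Z, IsGeodesicSegment x y A
  catNeg : ∀ z ∈ Z, ∀ x ∉ Z, dist x z < ε →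
    ∃ S, IsCATNeg k S ∧ ∃ ρ > 0, Metric.ball x ρ ⊆ S

variable {ε δ D k : ℝ} {mid : X → X → X} {N : ℕ}

/-- Curve shortening, applied to a sequence of close closed polygons, converges along a
subsequence to closed geodesics of the same speed. -/
lemma IsMidpointMap.exists_limit [NeZero N] [CompactSpace X] (hm : IsMidpointMap ε mid) (hε : 0 < ε)
    (hδ : δ < ε / 3) (hD : D < ε / 3) {C : ℕ → ZMod N → X}
    (hC : ∀ j i, dist (C j i) (C j (i + 1)) ≤ δ) (hCD : ∀ j i, dist (C j i) (C (j + 1) i) ≤ D) :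
    ∃ (C' : ℕ → ZMod N → X) (a : ℝ) (φ : ℕ → ℕ),
      (∀ j i, Tendsto (fun n => (shorten mid)^[φ n] (C j) i) atTop (𝓝 (C' j i))) ∧
      (∀ j, IsClosedGeodesic (C' j) a) ∧ (∀ j i, dist (C' j i) (C' (j + 1) i) ≤ D) ∧ a ≤ δ := by
  have hδ' : δ < ε := by linarith
  -- Compactness of the countable product gives one subsequence for all stages `j`.
  obtain ⟨C', φ, hφ, hlim⟩ := CompactSpace.tendsto_subseq
    (fun n : ℕ => fun j : ℕ => (shorten mid)^[n] (C j))
  have hlim' : ∀ j i, Tendsto (fun n => (shorten mid)^[φ n] (C j) i) atTop (𝓝 (C' j i)) :=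
    fun j i => tendsto_pi_nhds.1 (tendsto_pi_nhds.1 hlim j) i
  have hDn : ∀ n j i, dist ((shorten mid)^[n] (C j) i) ((shorten mid)^[n] (C (j + 1)) i) ≤ D := by
    intro n
    induction n with
    | zero => exact hCD
    | succ n ih =>
      intro j i
      simp only [Function.iterate_succ_apply']
      exact hm.dist_shorten_shorten_le hδ hD (hm.dist_iterate_shorten_succ_le hδ' (hC j) n)
        (hm.dist_iterate_shorten_succ_le hδ' (hC (j + 1)) n) (ih j) i
  have hD' : ∀ j i, dist (C' j i) (C' (j + 1) i) ≤ D := fun j i =>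
    le_of_tendsto ((hlim' j i).dist (hlim' (j + 1) i)) (Eventually.of_forall fun n => hDn _ j i)
  have hδ'' : ∀ j i, dist (C' j i) (C' j (i + 1)) ≤ δ := fun j i =>
    le_of_tendsto ((hlim' j i).dist (hlim' j (i + 1)))
      (Eventually.of_forall fun n => hm.dist_iterate_shorten_succ_le hδ' (hC j) _ i)
  choose a ha using fun j => hm.isClosedGeodesic_of_tendsto hδ hε (hC j) hφ (hlim' j)
  have haδ : ∀ j, a j ≤ δ := fun j => (ha j 0).1 ▸ hδ'' j 0
  have hconst : ∀ j, a j = a 0 := by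
    intro j
    induction j with
    | zero => rfl
    | succ j ih =>
      rw [← ih]
      exact (hm.flat_of_isClosedGeodesic ((haδ j).trans_lt hδ) ((haδ (j + 1)).trans_lt hδ) hD
        (ha j) (ha (j + 1)) (hD' j)).1.symm
  exact ⟨C', a 0, φ, hlim', fun j => hconst j ▸ ha j, hD', haδ 0⟩

namespace IsNegativelyCurvedScale

variable {Z : Set X}

lemma shorten_iterate_mem (hs : IsNegativelyCurvedScale Z k ε mid) (hδ : δ < ε) {c : ZMod N → X}
    (hc : ∀ i, dist (c i) (c (i + 1)) ≤ δ) (hcZ : ∀ i, c i ∈ Z) (n : ℕ) (i : ZMod N) :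
    (shorten mid)^[n] c i ∈ Z := by
  induction n generalizing i with
  | zero => exact hcZ i
  | succ n ih =>
    rw [Function.iterate_succ_apply']
    exact hs.mid_mem _ (ih i) _ (ih (i + 1))
      ((hs.isMidpointMap.dist_iterate_shorten_succ_le hδ hc n i).trans_lt hδ)

lemma dist_iterate_succ_le (hs : IsNegativelyCurvedScale Z k ε mid) (hδ : δ < ε) {c : ZMod N → X}
    (hc : ∀ i, dist (c i) (c (i + 1)) ≤ δ) (n : ℕ) (i : ZMod N) :
    dist ((shorten mid)^[n] c i) ((shorten mid)^[n + 1] c i) ≤ δ := by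
  rw [Function.iterate_succ_apply']
  exact hs.isMidpointMap.dist_self_shorten_le hδ
    (hs.isMidpointMap.dist_iterate_shorten_succ_le hδ hc n) i

variable [NeZero N] [CompactSpace X]

/-- A closed polygon in `Z` that is freely homotopic to a constant one is null-homotopic in `Z`. -/
lemma isNullChain_of_const (hs : IsNegativelyCurvedScale Z k ε mid) (hδ : δ < ε / 10)
    {C : ℕ → ZMod N → X} (hC : ∀ j i, dist (C j i) (C j (i + 1)) ≤ δ)
    (hCD : ∀ j i, dist (C j i) (C (j + 1) i) ≤ δ) {M : ℕ} (hM : ∀ i, C M i = C M (i + 1))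
    {c : ZMod N → Z} (hc : ∀ i, C 0 i = c i) : IsNullChain hs.simplyConnected_subspace c := by
  have hm := hs.isMidpointMap
  have hε := hs.pos
  have hδε : δ < ε := by linarith
  have hδ0 : 0 ≤ δ := dist_nonneg.trans (hC 0 0)
  have hZ : ∀ i, C 0 i ∈ Z := fun i => hc i ▸ (c i).2
  obtain ⟨C', a, φ, hlim, hgeo, hD, haδ⟩ := hm.exists_limit hε (by linarith : δ < ε / 3)
    (by linarith : δ < ε / 3) hC hCD
  -- The constant polygon `C M` has edges of length zero, and shortening keeps them so; the speed is
  -- common to all stages.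
  have ha : a = 0 := by
    rw [← (hgeo M 0).1]
    refine le_antisymm (le_of_tendsto ((hlim M 0).dist (hlim M (0 + 1)))
      (Eventually.of_forall fun n => ?_)) dist_nonneg
    exact hm.dist_iterate_shorten_succ_le hε (fun i => by rw [← hM i, dist_self]) _ 0
  subst ha
  let u : ℕ → ZMod N → Z := fun n i =>
    ⟨(shorten mid)^[n] (C 0) i, hs.shorten_iterate_mem hδε (hC 0) hZ n i⟩
  let v : ZMod N → Z := fun i => ⟨C' 0 i, hs.isClosed.mem_of_tendsto (hlim 0 i)
    (Eventually.of_forall fun n => hs.shorten_iterate_mem hδε (hC 0) hZ _ i)⟩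
  have hu0 : u 0 = c := by
    funext i
    exact Subtype.ext (hc i)
  have hpos : 0 < ε / 10 := by positivity
  obtain ⟨n, hn⟩ := (eventually_all.2 fun i => (tendsto_iff_dist_tendsto_zero.1
    (hlim 0 i)).eventually_lt_const hpos).exists
  have hstep := fun n i => hm.dist_iterate_shorten_succ_le hδε (hC 0) n i
  have hv : ∀ i, dist (v i) (v (i + 1)) ≤ 0 := fun i => ((hgeo 0 i).1).le
  rw [← hu0]
  refine IsNullChain.of_iterate (η := ε / 10) (by linarith)
    (fun n i => (hstep n i).trans hδ.le)
    (fun n i => (hs.dist_iterate_succ_le hδε (hC 0) n i).trans hδ.le) (n := φ n) ?_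
  refine IsNullChain.of_close (η := ε / 10) (by linarith)
    (fun i => (hstep (φ n) i).trans hδ.le) (fun i => ?_)
    (isNullChain_of_mul_lt hs.simplyConnected_subspace hv (by simpa using hε))
  rw [dist_comm]
  exact (hn i).le

/-- The track of a free homotopy between essential closed polygons in `Z` is homotopic into `Z`. -/
lemma isHomotopicInto_of_not_isNullChain (hs : IsNegativelyCurvedScale Z k ε mid)
    (hδ : δ < ε / 10) (hD : D < ε / 10) (hND : N * D < ε)
    {C : ℕ → ZMod N → X} (hC : ∀ j i, dist (C j i) (C j (i + 1)) ≤ δ)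
    (hCD : ∀ j i, dist (C j i) (C (j + 1) i) ≤ D) {M : ℕ} (hM : ∀ j ≥ M, C j = C M)
    (h0 : ∀ i, C 0 i ∈ Z) (h1 : ∀ i, C M i ∈ Z)
    (hnull : ¬ IsNullChain hs.simplyConnected (C 0))
    (ht : ∀ j, dist (C j 0) (C (j + 1) 0) < ε) :
    IsHomotopicInto Z (hs.simplyConnected.chain (fun j => C j 0) ht M) := by
  have hm := hs.isMidpointMap
  have hε := hs.pos
  have hδε : δ < ε := by linarith
  have hpos : 0 < ε / 10 := by positivity
  have hstep := fun j n i => hm.dist_iterate_shorten_succ_le hδε (hC j) n i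
  obtain ⟨C', a, φ, hlim, hgeo, hD', haδ⟩ := hm.exists_limit hε (by linarith : δ < ε / 3)
    (by linarith : D < ε / 3) hC hCD
  have hM' : ∀ j ≥ M, C' j = C' M := fun j hj => funext fun i =>
    tendsto_nhds_unique (hlim j i) (by rw [hM j hj]; exact hlim M i)
  have hmem : ∀ j, (∀ i, C j i ∈ Z) → ∀ i, C' j i ∈ Z := fun j hj i =>
    hs.isClosed.mem_of_tendsto (hlim j i)
      (Eventually.of_forall fun n => hs.shorten_iterate_mem hδε (hC j) hj _ i)
  -- The stages are constant from `M` on, so one `n` is close enough to the limit for all of them.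
  obtain ⟨n, hn⟩ := (eventually_all.2 fun j : Fin (M + 1) => eventually_all.2 fun i =>
    (tendsto_iff_dist_tendsto_zero.1 (hlim j i)).eventually_lt_const hpos).exists
  have hn' : ∀ j i, dist ((shorten mid)^[φ n] (C j) i) (C' j i) < ε / 10 := by
    intro j i
    rcases le_total j M with hj | hj
    · exact hn ⟨j, by omega⟩ i
    · rw [hM j hj, hM' j hj]; exact hn ⟨M, by omega⟩ i
  -- Otherwise the limit polygon would have total length at most `N * D < ε`, and `C 0` would be
  -- null-homotopic.
  have hDa : D < a := by
    by_contra! hle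
    refine hnull (IsNullChain.of_iterate (η := ε / 10) (by linarith)
      (u := fun n => (shorten mid)^[n] (C 0)) (fun n i => (hstep 0 n i).trans hδ.le)
      (fun n i => (hs.dist_iterate_succ_le hδε (hC 0) n i).trans hδ.le) (n := φ n) ?_)
    refine IsNullChain.of_close (c := C' 0) (η := ε / 10) (by linarith)
      (fun i => (hstep 0 (φ n) i).trans hδ.le)
      (fun i => by rw [dist_comm]; exact (hn' 0 i).le)
      (isNullChain_of_mul_lt _ (fun i => ((hgeo 0 i).1.trans_le hle)) hND)
  have hZ : ∀ j i, C' j i ∈ Z := by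
    intro j
    induction j with
    | zero => exact hmem 0 h0
    | succ j ih =>
      refine hm.mem_of_isClosedGeodesic hs.curvature_pos (by linarith) hDa (hgeo j)
        (hgeo (j + 1)) (hD' j) (fun i => ?_) (fun i hi => ?_)
      · exact hs.geodesic _ (ih i) _ (ih _) (by rw [(hgeo j i).2]; linarith)
      · exact hs.catNeg _ (ih i) _ hi (by rw [dist_comm]; linarith [hD' j i])
  have hDn : ∀ n j, dist ((shorten mid)^[n] (C j) 0) ((shorten mid)^[n] (C (j + 1)) 0) ≤ D := by
    intro n
    suffices ∀ j i, dist ((shorten mid)^[n] (C j) i) ((shorten mid)^[n] (C (j + 1)) i) ≤ D from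
      fun j => this j 0
    induction n with
    | zero => exact hCD
    | succ n ih =>
      intro j i
      simp only [Function.iterate_succ_apply']
      exact hm.dist_shorten_shorten_le (by linarith : δ < ε / 3) (by linarith) (hstep j n)
        (hstep (j + 1) n) (ih j) i
  have hDε : ∀ n j, dist ((shorten mid)^[n] (C j) 0) ((shorten mid)^[n] (C (j + 1)) 0) < ε :=
    fun n j => by linarith [hDn n j]
  have hDε' : ∀ j, dist (C' j 0) (C' (j + 1) 0) < ε := fun j => by linarith [hD' j 0]
  have hZn := fun n => hs.shorten_iterate_mem hδε (hC 0) h0 n 0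
  have hZn' := fun n => hs.shorten_iterate_mem hδε (hC M) h1 n 0
  -- Descent through the iterations: each step moves the track slightly, with both ends staying in
  -- `Z`.
  have key : ∀ n, IsHomotopicInto Z (hs.simplyConnected.chain
      (fun j => (shorten mid)^[n] (C j) 0) (hDε n) M) →
      IsHomotopicInto Z (hs.simplyConnected.chain (fun j => C j 0) ht M) := by
    intro n
    induction n with
    | zero => exact id
    | succ n ih =>
      have hmove := fun j => hs.dist_iterate_succ_le hδε (hC j) n 0
      refine fun h => ih (hs.simplyConnected.chain_isHomotopicInto_of_close
        hs.simplyConnected_subspace (hDε (n + 1)) (hDε n)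
        (fun j => ?_) (fun j => ?_) (hZn _) (hZn' _) (hZn _) (hZn' _) ?_ ?_ h)
      · rw [dist_comm]; linarith [hmove j]
      · have h1 := dist_triangle_left ((shorten mid)^[n + 1] (C j) 0)
          ((shorten mid)^[n] (C (j + 1)) 0) ((shorten mid)^[n] (C j) 0)
        linarith [hmove j, hDn n j]
      · rw [dist_comm]; linarith [hmove 0]
      · rw [dist_comm]; linarith [hmove M]
  refine key (φ n) (hs.simplyConnected.chain_isHomotopicInto_of_close
    hs.simplyConnected_subspace hDε' (hDε (φ n)) (fun j => ?_) (fun j => ?_) (hZ _ _) (hZ _ _)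
    (hZn _) (hZn' _) ?_ ?_
    (hs.simplyConnected.chain_isHomotopicInto hs.simplyConnected_subspace hDε' (fun j _ => hZ j 0)
      hDε'))
  · rw [dist_comm]; linarith [hn' j 0]
  · have h1 := dist_triangle_left (C' j 0)
      ((shorten mid)^[φ n] (C (j + 1)) 0) ((shorten mid)^[φ n] (C j) 0)
    linarith [hn' j 0, hDn (φ n) j]
  · rw [dist_comm]; linarith [hn' 0 0]
  · rw [dist_comm]; linarith [hn' M 0]

end IsNegativelyCurvedScale

end Scale

/-! ### From paths to polygons -/

section Discretization

/-- The point `n / N` of the unit interval, truncated at `1`. -/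
noncomputable def gridPoint (N n : ℕ) : I := Set.projIcc 0 1 zero_le_one ((n : ℝ) / N)

lemma gridPoint_zero (N : ℕ) : gridPoint N 0 = 0 := by
  simp [gridPoint, Set.projIcc_left]

lemma gridPoint_of_le {N n : ℕ} (hN : N ≠ 0) (h : N ≤ n) : gridPoint N n = 1 := by
  refine Set.projIcc_of_right_le _ ?_
  rw [le_div_iff₀ (by positivity), one_mul]
  exact_mod_cast h

lemma gridPoint_mono (N : ℕ) : Monotone (gridPoint N) := fun m n h =>
  Set.monotone_projIcc _ (by gcongr)

lemma dist_gridPoint_le (N n : ℕ) {s : I}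
    (hs : s ∈ Set.Icc (gridPoint N n) (gridPoint N (n + 1))) :
    dist (gridPoint N n) s ≤ 1 / N := by
  have h1 : dist (gridPoint N n) s ≤ dist (gridPoint N n) (gridPoint N (n + 1)) := by
    simp only [Subtype.dist_eq, Real.dist_eq]
    have a1 : (gridPoint N n : ℝ) ≤ s := hs.1
    have a2 : (s : ℝ) ≤ gridPoint N (n + 1) := hs.2
    rw [abs_sub_comm, abs_of_nonneg (by linarith), abs_sub_comm, abs_of_nonneg (by linarith)]
    linarith
  refine h1.trans ?_
  simp only [gridPoint, Subtype.dist_eq]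
  rw [Real.dist_eq]
  refine (Set.abs_projIcc_sub_projIcc zero_le_one).trans ?_
  rw [← sub_div, Nat.cast_succ, sub_add_cancel_left, abs_div, abs_neg, abs_one, Nat.abs_cast]

lemma ZMod.apply_gridPoint_val {Y : Type*} {N : ℕ} [NeZero N] {f : I → Y} (hf : f 0 = f 1)
    {n : ℕ} (hn : n ≤ N) : f (gridPoint N (n : ZMod N).val) = f (gridPoint N n) := by
  rcases hn.lt_or_eq with h | rfl
  · rw [ZMod.val_natCast_of_lt h]
  · rw [ZMod.natCast_self, ZMod.val_zero, gridPoint_zero,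
      gridPoint_of_le (NeZero.ne n) le_rfl, hf]

lemma ZMod.apply_gridPoint_val_add_one {Y : Type*} {N : ℕ} [NeZero N] {f : I → Y}
    (hf : f 0 = f 1) (i : ZMod N) :
    f (gridPoint N (i + 1).val) = f (gridPoint N (i.val + 1)) := by
  have : i + 1 = ((i.val + 1 : ℕ) : ZMod N) := by simp
  rw [this]
  exact ZMod.apply_gridPoint_val hf (ZMod.val_lt i)

variable {Y : Type*} [MetricSpace Y] {ε : ℝ}

lemma IsSimplyConnectedAtScale.chain_congr (hY : IsSimplyConnectedAtScale Y ε) {c c' : ℕ → Y}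
    (hc : ∀ i, dist (c i) (c (i + 1)) < ε) (hc' : ∀ i, dist (c' i) (c' (i + 1)) < ε) {n : ℕ}
    (h : ∀ i ≤ n, c i = c' i) :
    hY.chain c hc n = (hY.chain c' hc' n).cast (h 0 n.zero_le) (h n le_rfl) := by
  have hcast : ∀ {x y z x' y' z' : Y} (hx : x = x') (hy : y = y') (hz : z = z')
      (p : Path.Homotopic.Quotient x' y') (hd : dist y z < ε) (hd' : dist y' z' < ε),
      (p.cast hx hy).trans (hY.edge hd) = (p.trans (hY.edge hd')).cast hx hz := by
    rintro x y z _ _ _ rfl rfl rfl p hd hd'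
    simp only [Path.Homotopic.Quotient.cast_rfl_rfl]
  induction n with
  | zero =>
    have : ∀ {x y : Y} (h : x = y), Path.Homotopic.Quotient.refl x =
        (Path.Homotopic.Quotient.refl y).cast h h := by
      rintro x _ rfl; rw [Path.Homotopic.Quotient.cast_rfl_rfl]
    exact this _
  | succ n ih =>
    rw [IsSimplyConnectedAtScale.chain, IsSimplyConnectedAtScale.chain,
      ih fun i hi => h i (by omega)]
    exact hcast _ _ _ _ _ _

lemma IsSimplyConnectedAtScale.chain_gridPoint (hY : IsSimplyConnectedAtScale Y ε) {a b : Y}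
    (γ : Path a b) {N : ℕ} (hN : N ≠ 0)
    (hc : ∀ i, dist (γ (gridPoint N i)) (γ (gridPoint N (i + 1))) < ε)
    (h : ∀ s t, dist s t ≤ 1 / (N : ℝ) → dist (γ s) (γ t) < ε) :
    hY.chain (fun i => γ (gridPoint N i)) hc N = (Path.Homotopic.Quotient.mk γ).cast
      (by rw [gridPoint_zero, γ.source]) (by rw [gridPoint_of_le hN le_rfl, γ.target]) := by
  rw [hY.chain_eq_subpath γ (gridPoint_mono N) hc fun i s hs => h _ _ (dist_gridPoint_le N i hs),
    ← Path.Homotopic.Quotient.mk_cast]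
  congr 1
  ext s
  rw [Path.subpath, Path.cast_coe]
  simp [gridPoint_zero, gridPoint_of_le hN le_rfl]

lemma IsSimplyConnectedAtScale.cast_eq_edge_iff (hY : IsSimplyConnectedAtScale Y ε) {x y a : Y}
    (hx : x = a) (hy : y = a) (q : Path.Homotopic.Quotient a a) (h : dist x y < ε) :
    q.cast hx hy = hY.edge h ↔ q = Path.Homotopic.Quotient.refl a := by
  subst hx hy
  rw [hY.edge_self, Path.Homotopic.Quotient.cast_rfl_rfl]

/-- The dictionary between polygons and loops: a sufficiently fine inscribed polygon represents the
loop, closing up at `N` because `γ 0 = γ 1`. -/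
lemma isNullChain_iff (hY : IsSimplyConnectedAtScale Y ε) {a : Y} (γ : Path a a)
    {N : ℕ} [NeZero N] (h : ∀ s t, dist s t ≤ 1 / (N : ℝ) → dist (γ s) (γ t) < ε) :
    IsNullChain hY (fun i : ZMod N => γ (gridPoint N i.val)) ↔
      Path.Homotopic.Quotient.mk γ = Path.Homotopic.Quotient.refl a := by
  have hγ : γ 0 = γ 1 := by rw [γ.source, γ.target]
  have hc' : ∀ i, dist (γ (gridPoint N i)) (γ (gridPoint N (i + 1))) < ε := fun i =>
    h _ _ (dist_gridPoint_le N i ⟨gridPoint_mono N i.le_succ, le_rfl⟩)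
  have hval : ∀ i ≤ N, γ (gridPoint N (i : ZMod N).val) = γ (gridPoint N i) := fun i hi =>
    ZMod.apply_gridPoint_val hγ hi
  have key : ∀ hc h0, hY.chain (fun i : ℕ => γ (gridPoint N (i : ZMod N).val)) hc N =
      hY.edge h0 ↔ Path.Homotopic.Quotient.mk γ = Path.Homotopic.Quotient.refl a := by
    intro hc h0
    rw [hY.chain_congr hc hc' hval, hY.chain_gridPoint γ (NeZero.ne N) hc' h,
      Path.Homotopic.Quotient.cast_cast, hY.cast_eq_edge_iff]
  constructor
  · rintro ⟨hc, h0, he⟩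
    exact (key hc h0).1 he
  · intro he
    have h0 : dist (γ (gridPoint N ((0 : ℕ) : ZMod N).val))
        (γ (gridPoint N ((N : ℕ) : ZMod N).val)) < ε := by
      have := h 0 0 (by simp)
      rw [dist_self] at this
      simpa using this
    have hc : ∀ i : ℕ, dist (γ (gridPoint N (i : ZMod N).val))
        (γ (gridPoint N ((i + 1 : ℕ) : ZMod N).val)) < ε := fun i => by
      rw [Nat.cast_succ, ZMod.apply_gridPoint_val_add_one hγ]
      exact hc' _
    exact ⟨hc, h0, (key hc h0).2 he⟩

end Discretization

/-! ### From polygons to homotopies of loops -/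

section Homotopies

variable {X : Type*} [MetricSpace X]

lemma exists_mesh {A B : Type*} [PseudoMetricSpace A] [CompactSpace A] [PseudoMetricSpace B]
    (F : C(A, B)) {η : ℝ} (hη : 0 < η) :
    ∃ N : ℕ, N ≠ 0 ∧ ∀ p q, dist p q ≤ 1 / (N : ℝ) → dist (F p) (F q) ≤ η := by
  obtain ⟨ρ, hρ, h⟩ := Metric.uniformContinuous_iff.1
    (CompactSpace.uniformContinuous_of_continuous F.continuous) η hη
  obtain ⟨n, hn⟩ := exists_nat_one_div_lt hρ
  refine ⟨n + 1, n.succ_ne_zero, fun p q hpq => (h (hpq.trans_lt ?_)).le⟩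
  push_cast
  exact hn

namespace IsNegativelyCurvedScale

variable [CompactSpace X] {Z : Set X} {k ε : ℝ} {mid : X → X → X}

/-- A loop in `Z` that is freely homotopic to a constant loop in `X` is null-homotopic in `Z`. -/
lemma mk_eq_refl_of_homotopy (hs : IsNegativelyCurvedScale Z k ε mid) {z : Z} (α : Path z z)
    (F : C(I × I, X)) (hF : ∀ s, F (s, 0) = F (s, 1)) (h0 : ∀ u, F (0, u) = α u)
    (h1 : ∀ u, F (1, u) = F (1, 0)) :
    Path.Homotopic.Quotient.mk α = Path.Homotopic.Quotient.refl z := by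
  have hε := hs.pos
  obtain ⟨N, hN, h⟩ := exists_mesh F (by positivity : 0 < ε / 20)
  have : NeZero N := ⟨hN⟩
  rw [← isNullChain_iff hs.simplyConnected_subspace (N := N)]
  · refine hs.isNullChain_of_const (δ := ε / 20) (by linarith)
      (C := fun j i => F (gridPoint N j, gridPoint N i.val)) (M := N) (fun j i => ?_)
      (fun j i => ?_) (fun i => ?_) (fun i => ?_)
    · rw [ZMod.apply_gridPoint_val_add_one (f := fun u => F (gridPoint N j, u)) (hF _)]
      refine h _ _ ?_
      rw [dist_prod_same_left]
      exact dist_gridPoint_le N _ ⟨gridPoint_mono N (Nat.le_succ _), le_rfl⟩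
    · refine h _ _ ?_
      rw [dist_prod_same_right]
      exact dist_gridPoint_le N _ ⟨gridPoint_mono N (Nat.le_succ _), le_rfl⟩
    · simp only [gridPoint_of_le hN le_rfl]
      rw [h1, h1 (gridPoint N (i + 1).val)]
    · rw [gridPoint_zero, h0]
  · intro s t hst
    rw [Subtype.dist_eq, ← h0, ← h0]
    refine (h _ _ ?_).trans_lt (by linarith)
    rwa [dist_prod_same_left]

/-- The track of a free homotopy in `X` between loops in `Z`, the first of which is essential in
`X`, is homotopic into `Z`. -/
lemma isHomotopicInto_of_homotopy (hs : IsNegativelyCurvedScale Z k ε mid) {x : X} (α : Path x x)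
    (F : C(I × I, X)) (hF : ∀ s, F (s, 0) = F (s, 1)) (h0 : ∀ u, F (0, u) = α u)
    (hα : ∀ u, α u ∈ Z) (h1 : ∀ u, F (1, u) ∈ Z)
    (hne : Path.Homotopic.Quotient.mk α ≠ Path.Homotopic.Quotient.refl x) {a b : X}
    (τ : Path a b) (hτ : ∀ s, F (s, 0) = τ s) :
    IsHomotopicInto Z (Path.Homotopic.Quotient.mk τ) := by
  have hε := hs.pos
  obtain ⟨N, hN, h⟩ := exists_mesh F (by positivity : 0 < ε / 20)
  have : NeZero N := ⟨hN⟩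
  have hN0 : (0 : ℝ) < N := by positivity
  -- The mesh of the homotopy parameter is chosen after `N`, since `N * D < ε` is needed.
  obtain ⟨M, hM, h'⟩ := exists_mesh F (lt_min (by positivity) (by positivity) :
    0 < min (ε / 20) (ε / (2 * N)))
  set D := min (ε / 20) (ε / (2 * N)) with hD
  have hD1 : D ≤ ε / 20 := min_le_left _ _
  have hND : N * D < ε := by
    have : N * D ≤ N * (ε / (2 * N)) := mul_le_mul_of_nonneg_left (min_le_right _ _) hN0.le
    have e : N * (ε / (2 * N)) = ε / 2 := by field_simp
    linarith
  rw [ne_eq, ← isNullChain_iff hs.simplyConnected (N := N)] at hne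
  swap
  · intro s t hst
    rw [← h0, ← h0]
    refine (h _ _ ?_).trans_lt (by linarith)
    rwa [dist_prod_same_left]
  have hCD : ∀ (j : ℕ) (u : I), dist (F (gridPoint M j, u)) (F (gridPoint M (j + 1), u)) ≤ D := by
    intro j u
    refine h' _ _ ?_
    rw [dist_prod_same_right]
    exact dist_gridPoint_le M _ ⟨gridPoint_mono M (Nat.le_succ _), le_rfl⟩
  have hsteps : ∀ j, dist (τ (gridPoint M j)) (τ (gridPoint M (j + 1))) < ε := fun j => by
    rw [← hτ, ← hτ]
    linarith [hCD j 0]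
  have hτ' : ∀ j, F (gridPoint M j, gridPoint N (0 : ZMod N).val) = τ (gridPoint M j) :=
    fun j => by rw [ZMod.val_zero, gridPoint_zero, hτ]
  have key := hs.isHomotopicInto_of_not_isNullChain (δ := ε / 20) (D := D) (by linarith)
    (by linarith) hND (C := fun j i => F (gridPoint M j, gridPoint N i.val)) (M := M)
    (fun j i => ?_) (fun j i => hCD j _) (fun j hj => ?_) (fun i => ?_) (fun i => ?_) ?_
    (fun j => by rw [hτ', hτ']; exact hsteps j)
  · rw [hs.simplyConnected.chain_congr _ hsteps (fun j _ => hτ' j),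
      hs.simplyConnected.chain_gridPoint τ hM hsteps] at key
    · have hcast : ∀ {a b a' b' : X} (ha : a' = a) (hb : b' = b)
          (q : Path.Homotopic.Quotient a b), IsHomotopicInto Z (q.cast ha hb) →
          IsHomotopicInto Z q := by
        rintro a b _ _ rfl rfl q hq
        rwa [Path.Homotopic.Quotient.cast_rfl_rfl] at hq
      exact hcast _ _ _ (hcast _ _ _ key)
    · intro s t hst
      rw [← hτ, ← hτ]
      refine (h' _ _ ?_).trans_lt (by linarith)
      rwa [dist_prod_same_right]
  · rw [ZMod.apply_gridPoint_val_add_one (f := fun u => F (gridPoint M j, u)) (hF _)]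
    refine h _ _ ?_
    rw [dist_prod_same_left]
    exact dist_gridPoint_le N _ ⟨gridPoint_mono N (Nat.le_succ _), le_rfl⟩
  · funext i
    simp only [gridPoint_of_le hM hj, gridPoint_of_le hM le_rfl]
  · rw [gridPoint_zero, h0]
    exact hα _
  · rw [gridPoint_of_le hM le_rfl]
    exact h1 _
  · simpa only [gridPoint_zero, h0] using hne

end IsNegativelyCurvedScale

end Homotopies

/-! ### Existence of a good scale -/

section Existence

lemma IsSimplyConnectedAtScale.mono {Y : Type*} [MetricSpace Y] {ε ε' : ℝ}
    (hY : IsSimplyConnectedAtScale Y ε) (h : ε' ≤ ε) : IsSimplyConnectedAtScale Y ε' :=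
  ⟨fun x y hxy => hY.exists_path x y (hxy.trans_le h), fun x a b γ γ' h1 h2 =>
    hY.homotopic x a b γ γ' (fun t => (h1 t).trans_le (by linarith))
      (fun t => (h2 t).trans_le (by linarith))⟩

lemma IsMidpointMap.mono {Y : Type*} [MetricSpace Y] {ε ε' : ℝ} {mid : Y → Y → Y}
    (hm : IsMidpointMap ε mid) (h : ε' ≤ ε) : IsMidpointMap ε' mid :=
  ⟨fun hxy => hm.dist_left (hxy.trans_le h), fun hxy => hm.dist_right (hxy.trans_le h),
    fun hxy hp => hm.cn (hxy.trans_le h) (hp.trans_le h)⟩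

lemma exists_isNegativelyCurvedScale {X : Type*} [MetricSpace X] [CompactSpace X]
    (hX : IsLocallyCATZero (Set.univ : Set X)) {Z : Set X} (hZ : IsCompact Z)
    (hZconv : IsLocallyConvex Z) (hneg : IsNegativelyCurvedAround Z) :
    ∃ k ε mid, IsNegativelyCurvedScale Z k ε mid := by
  have : CompactSpace Z := isCompact_iff_compactSpace.1 hZ
  have hZ0 := hZconv.isLocallyCATZero hX
  obtain ⟨ε₁, h₁, mid, hmid⟩ := hX.exists_isMidpointMap
  obtain ⟨ε₂, h₂, mid', hmid'⟩ := hZ0.exists_isMidpointMap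
  obtain ⟨ε₃, h₃, hsc⟩ := hX.exists_isSimplyConnectedAtScale
  obtain ⟨ε₄, h₄, hsc'⟩ := hZ0.exists_isSimplyConnectedAtScale
  obtain ⟨ε₅, h₅, hgeo⟩ := hZ0.exists_scale
  obtain ⟨U, hU, k, hk, hcat⟩ := hneg
  obtain ⟨V, hV, hZV, hVU⟩ := mem_nhdsSet_iff_exists.1 hU
  obtain ⟨ε₆, h₆, hthick⟩ := hZ.exists_thickening_subset_open hV hZV
  obtain ⟨ε, hε, l₁, l₂, l₃, l₄, l₅, l₆⟩ : ∃ ε > 0, ε ≤ ε₁ ∧ ε ≤ ε₂ ∧ ε ≤ ε₃ ∧ ε ≤ ε₄ ∧ ε ≤ ε₅ ∧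
      ε ≤ ε₆ := by
    refine ⟨min ε₁ (min ε₂ (min ε₃ (min ε₄ (min ε₅ ε₆)))), by positivity, ?_⟩
    simp
  refine ⟨k, ε, mid, hε, hk, hZ.isClosed, hmid.mono l₁, hsc.mono l₃, hsc'.mono l₄, ?_, ?_, ?_⟩
  · exact fun x hx y hy hxy => hmid.mem_of_mem hmid' hx hy (hxy.trans_le l₁) (hxy.trans_le l₂)
  · intro x hx y hy hxy
    obtain ⟨z, r, hr, hz, hS⟩ := hgeo ⟨x, hx⟩
    obtain ⟨A, hA, -⟩ := hS.1 ⟨x, hx⟩ (hz (Metric.mem_ball_self h₅)) ⟨y, hy⟩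
      (hz (by rw [Metric.mem_ball, dist_comm]; exact hxy.trans_le l₅))
    exact ⟨_, Subtype.coe_image_subset Z A, hA.image_val⟩
  · intro z hz x hx hxz
    have hxV : x ∈ V := hthick (Metric.mem_thickening_iff.2 ⟨z, hz, hxz.trans_le l₆⟩)
    obtain ⟨r, hr, hS⟩ := hcat x ⟨hVU hxV, hx⟩
    -- The CAT(-k) ball is a ball of `U \ Z` only; openness of `V \ Z` puts a ball of `X` inside it.
    obtain ⟨ρ, hρ, hball⟩ := Metric.isOpen_iff.1 (hV.sdiff hZ.isClosed) x ⟨hxV, hx⟩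
    refine ⟨_, hS, min ρ r, lt_min hρ hr, fun y hy => ⟨?_, ?_⟩⟩
    · have := hball (Metric.ball_subset_ball (min_le_left _ _) hy)
      exact ⟨hVU this.1, this.2⟩
    · exact Metric.ball_subset_ball (min_le_right _ _) hy

end Existence

/-! ### Free homotopies from conjugacy -/

section FreeHomotopy

variable {X : Type*} [TopologicalSpace X]

lemma Path.trans_apply_half {x y z : X} (p : Path x y) (q : Path y z) (t : I) :
    p.trans q (Set.projIcc 0 1 zero_le_one ((t : ℝ) / 2)) = p t := by
  have h : (t : ℝ) / 2 ∈ Set.Icc (0 : ℝ) 1 := ⟨by linarith [t.2.1], by linarith [t.2.2]⟩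
  rw [Set.projIcc_of_mem zero_le_one h, Path.trans_apply, dif_pos (by linarith [t.2.2])]
  congr 1
  ext
  simp only
  ring

lemma Path.trans_apply_half_add {x y z : X} (p : Path x y) (q : Path y z) (t : I) :
    p.trans q (Set.projIcc 0 1 zero_le_one (((1 : ℝ) + t) / 2)) = q t := by
  have h : ((1 : ℝ) + t) / 2 ∈ Set.Icc (0 : ℝ) 1 := ⟨by linarith [t.2.1], by linarith [t.2.2]⟩
  rw [Set.projIcc_of_mem zero_le_one h, Path.trans_apply]
  split_ifs with h1
  · have ht : t = 0 := by
      ext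
      have := t.2.1
      simp only at h1
      simp only [Set.Icc.coe_zero]
      linarith
    subst ht
    rw [q.source]
    refine (congrArg p (Subtype.ext ?_)).trans p.target
    simp
  · congr 1
    ext
    simp only
    ring

/-- A free homotopy between conjugate loops, whose track is the conjugating path. -/
lemma Path.Homotopic.exists_free_homotopy {x y : X} {α : Path x x} {γ : Path x y} {β : Path y y}
    (h : (α.trans γ).Homotopic (γ.trans β)) :
    ∃ (F : C(I × I, X)) (τ : Path x y), τ.Homotopic γ ∧ (∀ s, F (s, 0) = τ s) ∧
      (∀ s, F (s, 1) = τ s) ∧ (∀ u, F (0, u) = α u) ∧ ∀ u, F (1, u) = β u := by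
  obtain ⟨H⟩ := h
  -- `f k` runs from `0` to `1` on the third of the interval that starts at `k / 3`. The row `u ↦ F
  -- (s, u)` is a path across a window of half width in `H`. Its left end passes from `αγ` to `γβ`
  -- before the window slides, its right end after; so both ends trace `γ ∘ f 1`.
  let f : ℝ → I → I := fun k s => Set.projIcc 0 1 zero_le_one (3 * (s : ℝ) - k)
  have hf : ∀ k, Continuous (f k) := fun k => continuous_projIcc.comp (by fun_prop)
  have hf0 : ∀ (k : ℝ) (s : I), 3 * (s : ℝ) ≤ k → f k s = 0 := fun k s h =>
    Set.projIcc_of_le_left _ (by linarith)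
  have hf1 : ∀ (k : ℝ) (s : I), k + 1 ≤ 3 * (s : ℝ) → f k s = 1 := fun k s h =>
    Set.projIcc_of_right_le _ (by linarith)
  let τ : Path x y := γ.reparam (f 1) (hf 1) (hf0 _ _ (by simp)) (hf1 _ _ (by norm_num))
  let F : C(I × I, X) := ⟨fun p => H
    (Set.projIcc 0 1 zero_le_one ((1 - (p.2 : ℝ)) * f 0 p.1 + p.2 * f 2 p.1),
      Set.projIcc 0 1 zero_le_one (((f 1 p.1 : ℝ) + p.2) / 2)),
    H.continuous.comp ((continuous_projIcc.comp (by fun_prop)).prodMk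
      (continuous_projIcc.comp (by fun_prop)))⟩
  have hF : ∀ s u, F (s, u) = H
    (Set.projIcc 0 1 zero_le_one ((1 - (u : ℝ)) * f 0 s + u * f 2 s),
      Set.projIcc 0 1 zero_le_one (((f 1 s : ℝ) + u) / 2)) := fun _ _ => rfl
  have h0 : ∀ t, H (0, t) = (α.trans γ) t := fun t => H.apply_zero t
  have h1 : ∀ t, H (1, t) = (γ.trans β) t := fun t => H.apply_one t
  refine ⟨F, τ, ⟨(Path.Homotopy.reparam γ (f 1) (hf 1) _ _).symm⟩, fun s => ?_, fun s => ?_,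
    fun u => ?_, fun u => ?_⟩
  · change _ = γ (f 1 s)
    simp only [hF, Set.Icc.coe_zero, sub_zero, one_mul, zero_mul, add_zero, Set.projIcc_val]
    rcases le_total (3 * (s : ℝ)) 1 with h | h
    · rw [hf0 1 s h, γ.source]
      simp only [Set.Icc.coe_zero, zero_div, Set.projIcc_left]
      exact H.source _
    · rw [hf1 0 s (by linarith), h1, Path.trans_apply_half]
  · change _ = γ (f 1 s)
    simp only [hF, Set.Icc.coe_one, sub_self, one_mul, zero_mul, zero_add, Set.projIcc_val]
    rcases le_total 2 (3 * (s : ℝ)) with h | h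
    · rw [hf1 1 s (by linarith), γ.target]
      have : ((((1 : I) : ℝ) + 1) / 2) = 1 := by norm_num
      rw [this, Set.projIcc_right]
      exact H.target _
    · rw [hf0 2 s h, h0, add_comm, Path.trans_apply_half_add]
  · simp only [hF]
    rw [hf0 0 0 (by simp), hf0 1 0 (by simp), hf0 2 0 (by simp)]
    simp only [Set.Icc.coe_zero, mul_zero, add_zero, zero_add, Set.projIcc_left]
    exact (h0 _).trans (Path.trans_apply_half _ _ _)
  · simp only [hF]
    rw [hf1 0 1 (by norm_num), hf1 1 1 (by norm_num), hf1 2 1 (by norm_num)]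
    simp only [Set.Icc.coe_one, mul_one, sub_add_cancel, Set.projIcc_right]
    exact (h1 _).trans (Path.trans_apply_half_add _ _ _)

end FreeHomotopy

/-! ### Injectivity and malnormality -/

theorem mainTheorem12 {X : Type*} [MetricSpace X] [CompactSpace X]
    (hX : IsLocallyCATZero (Set.univ : Set X))
    (Z : Set X) (hZ : IsCompact Z) (hZconv : IsLocallyConvex Z)
    (hneg : IsNegativelyCurvedAround Z) (z : Z) :
    Function.Injective (inclusionPiOne Z z) ∧ IsMalnormal (inclusionPiOne Z z).range := by
  obtain ⟨k, ε, mid, hs⟩ := exists_isNegativelyCurvedScale hX hZ hZconv hneg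
  constructor
  · refine (injective_iff_map_eq_one _).2 fun p hp => ?_
    obtain ⟨α, rfl⟩ := Path.Homotopic.Quotient.mk_surjective p
    have h : (α.map continuous_subtype_val).Homotopic (Path.refl (z : X)) :=
      Path.Homotopic.Quotient.exact hp
    obtain ⟨H⟩ := h
    refine hs.mk_eq_refl_of_homotopy α H.toContinuousMap (fun s => ?_) (fun u => ?_) (fun u => ?_)
    · exact (H.source s).trans (H.target s).symm
    · exact H.apply_zero u
    · exact (H.apply_one u).trans (H.apply_one 0).symm
  · intro g hg
    rw [eq_bot_iff]
    rintro _ ⟨⟨_, ⟨a, rfl⟩, rfl⟩, ⟨b, hb⟩⟩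
    rw [Subgroup.mem_bot]
    by_contra hne
    refine hg ?_
    have hcomm : g * inclusionPiOne Z z a = inclusionPiOne Z z b * g := by
      rw [hb]
      exact (inv_mul_cancel_right (g * inclusionPiOne Z z a) g).symm
    have ha : inclusionPiOne Z z a ≠ 1 := by
      intro ha
      rw [ha] at hne
      simp at hne
    obtain ⟨α, rfl⟩ := Path.Homotopic.Quotient.mk_surjective a
    obtain ⟨β, rfl⟩ := Path.Homotopic.Quotient.mk_surjective b
    obtain ⟨γ, rfl⟩ := Path.Homotopic.Quotient.mk_surjective g
    -- Products in `FundamentalGroup` compose from right to left, so `g * a` is `α` followed by `γ`.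
    have h : ((α.map continuous_subtype_val).trans γ).Homotopic
        (γ.trans (β.map continuous_subtype_val)) := Path.Homotopic.Quotient.exact hcomm
    obtain ⟨F, τ, hτ, hF0, hF1, hα, hβ⟩ := h.exists_free_homotopy
    have key := hs.isHomotopicInto_of_homotopy (α.map continuous_subtype_val) F
      (fun s => by rw [hF0, hF1]) hα (fun u => (α u).2) (fun u => by rw [hβ]; exact (β u).2) ha
      τ hF0
    rw [Path.Homotopic.Quotient.eq.2 hτ] at key
    obtain ⟨z₁, z₂, p, h₁, h₂, hp⟩ := key
    obtain rfl := Subtype.ext h₁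
    obtain rfl := Subtype.ext h₂
    rw [Path.Homotopic.Quotient.cast_rfl_rfl] at hp
    exact ⟨p, hp.symm⟩
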